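/- **Setting.** Let $T>0$ and let $\alpha,\sigma\ge 0$ and $0\le\eta\le 1$ be real functions on $[0,T]$ with $\alpha_t^2+\sigma_t^2=1$, $\alpha$ nonincreasing, $\eta$ nondecreasing, and $\alpha,\eta$ differentiable with bounded derivatives. Put $$f(t)=\frac{d\log(\alpha_t(1-\eta_t))}{dt},\qquad h(t)=\frac{\alpha_t}{1-\eta_t}\frac{d\eta_t}{dt},\qquad g(t)=\sqrt{\frac{d\sigma_t^2}{dt}-2f(t)\sigma_t^2},\qquad \lambda_t=\frac{\sigma_t}{\alpha_t(1-\eta_t)}.$$ Let $\hat{\bm x}_0\in\mathbb R^d$, let $\bm x_\theta(\bm x,\hat{\bm x}_0,t)\in\mathbb R^d$ be a data-prediction model, and let $$\bm s_\theta(\bm x,t)=-\frac{\bm x-\big(\alpha_t(1-\eta_t)\,\bm x_\theta(\bm x,\hat{\bm x}_0,t)+\alpha_t\eta_t\hat{\bm x}_0\big)}{\sigma_t^2}.$$ Let $0<s\le T$ with $\alpha_s>0$, $\eta_s<1$ and $\sigma_t>0$ for all $t\in(0,s]$. Let $\bar{\bm w}$ be a standard $d$-dimensional Wiener process running backwards in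 time from $s$ to $0$, relative to a filtration $(\mathcal F_t)$ that increases as $t$ decreases, and let $(\bm x_t)_{t\in[0,s]}$ be an adapted process with almost surely continuous paths that solves, backwards from its ($\mathcal F_s$-measurable) value $\bm x_s$, the reverse-time SDE $$d\bm x_t=\big[f(t)\bm x_t+h(t)\hat{\bm x}_0-g^2(t)\,\bm s_\theta(\bm x_t,t)\big]dt+g(t)\,d\bar{\bm w}_t ,$$ that is, for every $t\in[0,s]$ with $\sigma_t>0$ the drift is almost surely integrable between $s$ and $t$ and the integrated equation from $s$ to $t$ holds almost surely. **Proposition (exact solution of diffusion DoS-SDEs).** There are random vectors $\bm z_t\sim\mathcal N(\bm 0,\bm I)$, $t\in[0,s]$, each independent of $\mathcal F_s$ (in particular of $\bm x_s$), such that almost surely, for every $t\in[0,s]$ with $\sigma_t>0$, $$\begin{aligned}\bm x_t={}&\frac{\alpha_t(1-\eta_t)}{\alpha_s(1-\eta_s)}\frac{\lambda_t^2}{\lambda_s^2}\bm x_s+\alpha_t(1-\eta_t)\Big(\frac{\eta_t}{1-\eta_t}-\frac{\eta_s}{1-\eta_s}\frac{\lambda_t^2}{\lambda_s^2}\Big)\hat{\bm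 x}_0\\&-\alpha_t(1-\eta_t)\int_{\lambda_s}^{\lambda_t}\frac{2\lambda_t^2}{\lambda^3}\,\bm x_\theta\big(\bm x_{t(\lambda)},\hat{\bm x}_0,t(\lambda)\big)\,d\lambda+\alpha_t(1-\eta_t)\sqrt{\lambda_t^2-\frac{\lambda_t^4}{\lambda_s^2}}\;\bm z_t ,\end{aligned}$$ where the integral converges absolutely and $t(\lambda)\in[0,s]$ is a time with $\lambda_{t(\lambda)}=\lambda$ (unique for all but countably many $\lambda$). If $\sigma_0=0$, so that the right-hand side is not defined at $t=0$, then almost surely $\bm x_0$ is its limit as $t\downarrow 0$. -/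

import Mathlib

open MeasureTheory ProbabilityTheory Filter Topology Set OrderDual

noncomputable section

namespace DoS

/-- A domain-shift noise schedule on the time interval `[0, T]`. -/
structure Schedule (T : ℝ) where
  α : ℝ → ℝ
  σ : ℝ → ℝ
  η : ℝ → ℝ
  α_nonneg : ∀ t ∈ Icc 0 T, 0 ≤ α t
  σ_nonneg : ∀ t ∈ Icc 0 T, 0 ≤ σ t
  sq_add_sq : ∀ t ∈ Icc 0 T, α t ^ 2 + σ t ^ 2 = 1
  η_mem : ∀ t ∈ Icc 0 T, η t ∈ Icc (0 : ℝ) 1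
  α_anti : AntitoneOn α (Icc 0 T)
  η_mono : MonotoneOn η (Icc 0 T)
  α_diff : DifferentiableOn ℝ α (Icc 0 T)
  η_diff : DifferentiableOn ℝ η (Icc 0 T)
  α_deriv_bdd : ∃ C, ∀ t ∈ Icc 0 T, |derivWithin α (Icc 0 T) t| ≤ C
  η_deriv_bdd : ∃ C, ∀ t ∈ Icc 0 T, |derivWithin η (Icc 0 T) t| ≤ C

namespace Schedule

variable {T : ℝ} (S : Schedule T)

/-- `f(t) = d log (α_t (1 - η_t)) / dt`. -/
def f (t : ℝ) : ℝ := derivWithin (fun u => Real.log (S.α u * (1 - S.η u))) (Icc 0 T) t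

/-- `h(t) = α_t / (1 - η_t) * dη_t / dt`. -/
def h (t : ℝ) : ℝ := S.α t / (1 - S.η t) * derivWithin S.η (Icc 0 T) t

/-- `g(t) = √(dσ_t² / dt - 2 f(t) σ_t²)`. -/
def g (t : ℝ) : ℝ :=
  √(derivWithin (fun u => S.σ u ^ 2) (Icc 0 T) t - 2 * S.f t * S.σ t ^ 2)

/-- `λ_t = σ_t / (α_t (1 - η_t))`. -/
def lam (t : ℝ) : ℝ := S.σ t / (S.α t * (1 - S.η t))

/-- `t(λ)`: a time in `[0, s]` at which the value `λ` is attained. It is the inverse of `t ↦ λ_t`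
where this map is strictly increasing; where it is only nondecreasing, at most countably many values
of `λ` are attained more than once. -/
def timeOf (s l : ℝ) : ℝ := Function.invFunOn S.lam (Icc 0 s) l

variable {d : ℕ}

/-- The score expressed through the data-prediction model `xθ`. -/
def score (xθ : EuclideanSpace ℝ (Fin d) → EuclideanSpace ℝ (Fin d) → ℝ → EuclideanSpace ℝ (Fin d))
    (xhat : EuclideanSpace ℝ (Fin d)) (t : ℝ) (x : EuclideanSpace ℝ (Fin d)) :
    EuclideanSpace ℝ (Fin d) :=
  -((1 / S.σ t ^ 2) • (x - ((S.α t * (1 - S.η t)) • xθ x xhat t + (S.α t * S.η t) • xhat)))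

/-- The drift of the reverse-time SDE. -/
def drift (xθ : EuclideanSpace ℝ (Fin d) → EuclideanSpace ℝ (Fin d) → ℝ → EuclideanSpace ℝ (Fin d))
    (xhat : EuclideanSpace ℝ (Fin d)) (t : ℝ) (x : EuclideanSpace ℝ (Fin d)) :
    EuclideanSpace ℝ (Fin d) :=
  S.f t • x + S.h t • xhat - S.g t ^ 2 • S.score xθ xhat t x

end Schedule

/-- A step function `∑ cᵢ 1_{(rᵢ, rᵢ₊₁]}` on `(t, s]`, where `t = r₀ ≤ r₁ ≤ ⋯ ≤ rₙ = s`. -/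
structure StepFn (t s : ℝ) where
  n : ℕ
  node : ℕ → ℝ
  val : ℕ → ℝ
  mono : Monotone node
  node_zero : node 0 = t
  node_last : node n = s

variable {Ω : Type*} {mΩ : MeasurableSpace Ω} {d : ℕ}

/-- The value of a step function at `r`. -/
def StepFn.eval {t s : ℝ} (φ : StepFn t s) (r : ℝ) : ℝ :=
  ∑ i ∈ Finset.range φ.n, (Ioc (φ.node i) (φ.node (i + 1))).indicator (fun _ => φ.val i) r

/-- The stochastic integral `∫_s^t φ dw` of a step function, with time running down from `s`
to `t`. -/
def StepFn.integral {t s : ℝ} (φ : StepFn t s) (w : ℝ → Ω → EuclideanSpace ℝ (Fin d)) (ω : Ω) :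
    EuclideanSpace ℝ (Fin d) :=
  ∑ i ∈ Finset.range φ.n, φ.val i • (w (φ.node i) ω - w (φ.node (i + 1)) ω)

/-- `J` is (a version of) the stochastic integral `∫_s^t φ dw`, for `t ≤ s`, of the deterministic
function `φ` against the backward Wiener process `w`: the `L²(P)`-limit of the integrals of step
functions that converge to `φ` in `L²(t, s)`. -/
def IsBackwardIntegral (P : Measure Ω) (w : ℝ → Ω → EuclideanSpace ℝ (Fin d)) (φ : ℝ → ℝ)
    (s t : ℝ) (J : Ω → EuclideanSpace ℝ (Fin d)) : Prop :=
  AEStronglyMeasurable φ (volume.restrict (Ioc t s)) ∧ AEStronglyMeasurable J P ∧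
  ∃ Φ : ℕ → StepFn t s,
    Tendsto (fun k => eLpNorm (fun r => (Φ k).eval r - φ r) 2 (volume.restrict (Ioc t s)))
      atTop (𝓝 0) ∧
    Tendsto (fun k => eLpNorm (fun ω => (Φ k).integral w ω - J ω) 2 P) atTop (𝓝 0)

/-- `w` is a standard `d`-dimensional Wiener process on `[0, s]` when time flows backwards from `s`,
relative to the filtration `𝓕`, which grows as time decreases. Only the increments of `w` matter,
so the value at the starting time `s` is not normalised. -/
structure IsBackwardWiener (P : Measure Ω) (𝓕 : Filtration ℝᵒᵈ mΩ)
    (w : ℝ → Ω → EuclideanSpace ℝ (Fin d)) (s : ℝ) : Prop where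
  adapted : ∀ t ∈ Icc 0 s, StronglyMeasurable[𝓕 (toDual t)] (w t)
  cont : ∀ᵐ ω ∂P, ContinuousOn (fun t => w t ω) (Icc 0 s)
  law_incr : ∀ t r, 0 ≤ t → t ≤ r → r ≤ s →
    HasLaw (fun ω => w t ω - w r ω)
      ((stdGaussian (EuclideanSpace ℝ (Fin d))).map (fun x => √(r - t) • x)) P
  indep_incr : ∀ t r, 0 ≤ t → t ≤ r → r ≤ s →
    Indep (MeasurableSpace.comap (fun ω => w t ω - w r ω) inferInstance) (𝓕 (toDual r)) P

/-- `X` is a solution on `[0, s]`, started at time `s`, of the reverse-time SDE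
`dx = [f x + h x̂₀ - g² score] dt + g dw`. The score is singular where `σ_t = 0`, so the integrated
equation is required from `s` down to every `t` with `σ_t > 0`; the paths are continuous on all of
`[0, s]`. -/
structure IsReverseSolution {T : ℝ} (S : Schedule T)
    (xθ : EuclideanSpace ℝ (Fin d) → EuclideanSpace ℝ (Fin d) → ℝ → EuclideanSpace ℝ (Fin d))
    (xhat : EuclideanSpace ℝ (Fin d)) (P : Measure Ω) (𝓕 : Filtration ℝᵒᵈ mΩ)
    (w : ℝ → Ω → EuclideanSpace ℝ (Fin d)) (s : ℝ)
    (X : ℝ → Ω → EuclideanSpace ℝ (Fin d)) : Prop where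
  adapted : ∀ t ∈ Icc 0 s, StronglyMeasurable[𝓕 (toDual t)] (X t)
  cont : ∀ᵐ ω ∂P, ContinuousOn (fun t => X t ω) (Icc 0 s)
  drift_integrable : ∀ t ∈ Icc 0 s, 0 < S.σ t →
    ∀ᵐ ω ∂P, IntervalIntegrable (fun r => S.drift xθ xhat r (X r ω)) volume s t
  equation : ∀ t ∈ Icc 0 s, 0 < S.σ t →
    IsBackwardIntegral P w S.g s t
      (fun ω => X t ω - X s ω - ∫ r in s..t, S.drift xθ xhat r (X r ω))

/-- The integrand `2 λ_t² / λ³ · x_θ(x_λ, x̂₀, λ)`, along one path `x` of the solution, where the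
index `λ` stands for the time `t(λ)`. -/
def integrand {T : ℝ} (S : Schedule T)
    (xθ : EuclideanSpace ℝ (Fin d) → EuclideanSpace ℝ (Fin d) → ℝ → EuclideanSpace ℝ (Fin d))
    (xhat : EuclideanSpace ℝ (Fin d)) (s : ℝ) (x : ℝ → EuclideanSpace ℝ (Fin d)) (t l : ℝ) :
    EuclideanSpace ℝ (Fin d) :=
  (2 * S.lam t ^ 2 / l ^ 3) • xθ (x (S.timeOf s l)) xhat (S.timeOf s l)

/-- The closed form at time `t`, with noise vector `z`, along one path `x` of the solution. -/
def closedForm {T : ℝ} (S : Schedule T)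
    (xθ : EuclideanSpace ℝ (Fin d) → EuclideanSpace ℝ (Fin d) → ℝ → EuclideanSpace ℝ (Fin d))
    (xhat : EuclideanSpace ℝ (Fin d)) (s : ℝ) (x : ℝ → EuclideanSpace ℝ (Fin d)) (t : ℝ)
    (z : EuclideanSpace ℝ (Fin d)) : EuclideanSpace ℝ (Fin d) :=
  ((S.α t * (1 - S.η t)) / (S.α s * (1 - S.η s)) * (S.lam t ^ 2 / S.lam s ^ 2)) • x s
  + (S.α t * (1 - S.η t) *
      (S.η t / (1 - S.η t) - S.η s / (1 - S.η s) * (S.lam t ^ 2 / S.lam s ^ 2))) • xhat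
  - (S.α t * (1 - S.η t)) • (∫ l in (S.lam s)..(S.lam t), integrand S xθ xhat s x t l)
  + (S.α t * (1 - S.η t) * √(S.lam t ^ 2 - S.lam t ^ 4 / S.lam s ^ 2)) • z

end DoS

end

/-! Write m = α(1-η)/σ² (`factor`). Multiplying the SDE by m removes its linear term, because m' =
-(f + g²/σ²)m, and leaves d(m x) = (αηm)' x̂₀ dt - m²g² x_θ dt + m g dw̄. Moreover m²g² (`rate`) is
the derivative of -1/λ², that is 2λ'/λ³. So the x̂₀ term integrates explicitly, the x_θ term becomes
an integral in λ, and the noise is Gaussian with variance ∫ m²g² = 1/λ_t² - 1/λ_s². Dividing by m_t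
= 1/(α_t(1-η_t)λ_t²) gives the formula.

No stochastic product rule is needed. The residual J_r = x_r - x_s - ∫ drift has continuous paths,
and each J_r is a version of the Wiener integral of g. Ordinary integration by parts along a path
(`sub_closedForm_zero`, resting on Fubini) identifies m_t times the difference between x_t and the
noiseless closed form with m_t J_t + ∫_t^s m' J du. The law of this vector is found in
`isIndepGaussian_integral_by_parts`: the time integral is a limit of finite combinations of the J_v,
which are Wiener integrals of deterministic functions, and characteristic functions restricted to
events of 𝓕_s pass to the limit.

The vector z_t is obtained by solving the formula for it, so the identity holds for all t at once
wherever the noise coefficient is nonzero. Where λ_t = λ_s the remainder is almost surely zero for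
each t, and a countable dense set together with continuity makes this simultaneous in t
(`ae_eq_closedForm_zero`). -/

noncomputable section

namespace DoS

/-! ### Gaussian vectors independent of a σ-algebra, via characteristic functions. -/

section Gaussian

variable {Ω : Type*} {m mΩ : MeasurableSpace Ω} {d : ℕ} {P : Measure Ω}

/-- `Y` is centred Gaussian with covariance `v • 1` and independent of `m`, in terms of
characteristic functions. -/
def IsIndepGaussian (P : Measure Ω) (m : MeasurableSpace Ω) (Y : Ω → EuclideanSpace ℝ (Fin d))
    (v : ℝ) : Prop :=
  ∀ A, MeasurableSet[m] A → ∀ ξ : EuclideanSpace ℝ (Fin d),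
    ∫ ω in A, Complex.exp ((inner ℝ (Y ω) ξ : ℝ) * Complex.I) ∂P
      = (P.real A : ℂ) * Complex.exp (-(v * ‖ξ‖ ^ 2 / 2 : ℝ))

theorem aestronglyMeasurable_cexp_inner {Y : Ω → EuclideanSpace ℝ (Fin d)}
    (hY : AEStronglyMeasurable Y P) (ξ : EuclideanSpace ℝ (Fin d)) :
    AEStronglyMeasurable (fun ω => Complex.exp ((inner ℝ (Y ω) ξ : ℝ) * Complex.I)) P := by
  have hc : Continuous fun y : EuclideanSpace ℝ (Fin d) =>
      Complex.exp ((inner ℝ y ξ : ℝ) * Complex.I) := by fun_prop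
  exact hc.comp_aestronglyMeasurable hY

/-- The defining identity tests only functions of modulus 1, so dominated convergence carries law
and independence to the limit together. -/
theorem IsIndepGaussian.of_tendsto_ae [IsProbabilityMeasure P]
    {Y : ℕ → Ω → EuclideanSpace ℝ (Fin d)} {Z : Ω → EuclideanSpace ℝ (Fin d)}
    {v : ℕ → ℝ} {u : ℝ} (hY : ∀ n, IsIndepGaussian P m (Y n) (v n))
    (hmeas : ∀ n, AEStronglyMeasurable (Y n) P)
    (hlim : ∀ᵐ ω ∂P, Tendsto (fun n => Y n ω) atTop (𝓝 (Z ω)))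
    (hv : Tendsto v atTop (𝓝 u)) : IsIndepGaussian P m Z u := by
  intro A hA ξ
  have h1 : Tendsto (fun n => ∫ ω in A, Complex.exp ((inner ℝ (Y n ω) ξ : ℝ) * Complex.I) ∂P) atTop
      (𝓝 (∫ ω in A, Complex.exp ((inner ℝ (Z ω) ξ : ℝ) * Complex.I) ∂P)) := by
    refine tendsto_integral_of_dominated_convergence (fun _ => (1 : ℝ)) ?_ ?_ ?_ ?_
    · exact fun n => (aestronglyMeasurable_cexp_inner (hmeas n) ξ).restrict
    · exact integrable_const _
    · intro n
      filter_upwards with ω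
      rw [Complex.norm_exp_ofReal_mul_I]
    · filter_upwards [ae_restrict_of_ae hlim] with ω hω
      have hc : Continuous fun y : EuclideanSpace ℝ (Fin d) =>
        Complex.exp ((inner ℝ y ξ : ℝ) * Complex.I) := by fun_prop
      exact (hc.tendsto _).comp hω
  have h2 : Tendsto (fun n => (P.real A : ℂ) * Complex.exp (-(v n * ‖ξ‖ ^ 2 / 2 : ℝ))) atTop
      (𝓝 ((P.real A : ℂ) * Complex.exp (-(u * ‖ξ‖ ^ 2 / 2 : ℝ)))) := by
    have hc : Continuous fun x : ℝ =>
      (P.real A : ℂ) * Complex.exp (-(x * ‖ξ‖ ^ 2 / 2 : ℝ)) := by fun_prop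
    exact (hc.tendsto _).comp hv
  refine tendsto_nhds_unique h1 ?_
  simpa only [hY _ A hA ξ] using h2

theorem IsIndepGaussian.congr_ae {Y Z : Ω → EuclideanSpace ℝ (Fin d)}
    {v : ℝ} (hY : IsIndepGaussian P m Y v) (h : Y =ᵐ[P] Z) : IsIndepGaussian P m Z v := by
  intro A hA ξ
  rw [← hY A hA ξ]
  refine integral_congr_ae ?_
  filter_upwards [ae_restrict_of_ae h] with ω hω
  rw [hω]

theorem IsIndepGaussian.const_smul {Y : Ω → EuclideanSpace ℝ (Fin d)}
    {v : ℝ} (hY : IsIndepGaussian P m Y v) (c : ℝ) :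
    IsIndepGaussian P m (fun ω => c • Y ω) (c ^ 2 * v) := by
  intro A hA ξ
  have := hY A hA (c • ξ)
  simp only [inner_smul_right, norm_smul, Real.norm_eq_abs, mul_pow, sq_abs] at this
  simp only [real_inner_smul_left]
  rw [this]
  congr 4
  ring

variable [IsProbabilityMeasure P]

/-- The law of `Y` under `P` restricted to `A` has the characteristic function of `P A` times the
standard Gaussian; uniqueness for finite measures does the rest. -/
theorem IsIndepGaussian.measure_inter (hm : m ≤ mΩ)
    {Y : Ω → EuclideanSpace ℝ (Fin d)} (hY : IsIndepGaussian P m Y 1) (hmeas : AEMeasurable Y P)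
    {A : Set Ω} (hA : MeasurableSet[m] A) {B : Set (EuclideanSpace ℝ (Fin d))}
    (hB : MeasurableSet B) :
    P (Y ⁻¹' B ∩ A) = P A * stdGaussian (EuclideanSpace ℝ (Fin d)) B := by
  have hmap : (P.restrict A).map Y = P A • stdGaussian (EuclideanSpace ℝ (Fin d)) := by
    have : IsFiniteMeasure (P A • stdGaussian (EuclideanSpace ℝ (Fin d))) :=
      Measure.smul_finite _ (measure_ne_top _ _)
    refine Measure.ext_of_charFun ?_
    funext ξ
    rw [charFun_apply, integral_map hmeas.restrict (by fun_prop), hY A hA ξ, charFun_apply,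
      integral_smul_measure, ← charFun_apply, charFun_stdGaussian]
    simp [Measure.real, neg_div, Complex.real_smul]
  have := congrArg (fun μ => μ B) hmap
  simp only [Measure.smul_apply, smul_eq_mul] at this
  rw [Measure.map_apply_of_aemeasurable hmeas.restrict hB,
    Measure.restrict_apply' (hm A hA)] at this
  exact this

theorem IsIndepGaussian.hasLaw (hm : m ≤ mΩ)
    {Y : Ω → EuclideanSpace ℝ (Fin d)} (hY : IsIndepGaussian P m Y 1) (hmeas : AEMeasurable Y P) :
    HasLaw Y (stdGaussian (EuclideanSpace ℝ (Fin d))) P := by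
  refine ⟨hmeas, ?_⟩
  ext B hB
  rw [Measure.map_apply_of_aemeasurable hmeas hB]
  simpa using hY.measure_inter hm hmeas MeasurableSet.univ hB

theorem IsIndepGaussian.indep (hm : m ≤ mΩ)
    {Y : Ω → EuclideanSpace ℝ (Fin d)} (hY : IsIndepGaussian P m Y 1) (hmeas : AEMeasurable Y P) :
    Indep (MeasurableSpace.comap Y inferInstance) m P := by
  rw [Indep_iff]
  rintro _ A ⟨B, hB, rfl⟩ hA
  have h1 := hY.measure_inter hm hmeas hA hB
  have h2 := hY.measure_inter hm hmeas MeasurableSet.univ hB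
  simp only [inter_univ, measure_univ, one_mul] at h2
  rw [h1, h2, mul_comm]

theorem IsIndepGaussian.ae_eq_zero
    {Y : Ω → EuclideanSpace ℝ (Fin d)} (hY : IsIndepGaussian P m Y 0) (hmeas : AEMeasurable Y P) :
    ∀ᵐ ω ∂P, Y ω = 0 := by
  have hmap : P.map Y = Measure.dirac 0 := by
    have := Measure.isProbabilityMeasure_map hmeas
    refine Measure.ext_of_charFun ?_
    funext ξ
    rw [charFun_apply, integral_map hmeas (by fun_prop), charFun_dirac]
    simpa using hY univ MeasurableSet.univ ξ
  refine ae_of_ae_map (p := fun y => y = 0) hmeas ?_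
  rw [hmap]
  simp [ae_dirac_eq]

end Gaussian

/-! ### Wiener integrals of step functions. -/

section Wiener

variable {Ω : Type*} {mΩ : MeasurableSpace Ω} {d : ℕ} {P : Measure Ω}
  {w : ℝ → Ω → EuclideanSpace ℝ (Fin d)} {s : ℝ}

/-- The random vector `∑ cₐ (w_a - w_s)`. -/
def wienerSum (w : ℝ → Ω → EuclideanSpace ℝ (Fin d)) (s : ℝ) :
    (ℝ →₀ ℝ) →ₗ[ℝ] (Ω → EuclideanSpace ℝ (Fin d)) :=
  Finsupp.linearCombination ℝ fun a ω => w a ω - w s ω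

/-- The step function `∑ cₐ 1_{(a, s]}`. -/
def stepSum (s : ℝ) : (ℝ →₀ ℝ) →ₗ[ℝ] (ℝ → ℝ) :=
  Finsupp.linearCombination ℝ fun a => (Ioc a s).indicator 1

theorem wienerSum_single (a x : ℝ) :
    wienerSum w s (Finsupp.single a x) = fun ω => x • (w a ω - w s ω) := by
  simp only [wienerSum, Finsupp.linearCombination_single]
  rfl

theorem stepSum_single (a x : ℝ) :
    stepSum s (Finsupp.single a x) = fun r => x * (Ioc a s).indicator 1 r := by
  simp only [stepSum, Finsupp.linearCombination_single]
  rfl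

theorem wienerSum_apply (c : ℝ →₀ ℝ) (ω : Ω) :
    wienerSum w s c ω = ∑ a ∈ c.support, c a • (w a ω - w s ω) := by
  simp [wienerSum, Finsupp.linearCombination_apply, Finsupp.sum]

theorem stepSum_apply (c : ℝ →₀ ℝ) (r : ℝ) :
    stepSum s c r = ∑ a ∈ c.support, c a * (Ioc a s).indicator 1 r := by
  simp [stepSum, Finsupp.linearCombination_apply, Finsupp.sum]

theorem measurable_stepSum (c : ℝ →₀ ℝ) : Measurable (stepSum s c) := by
  have : stepSum s c = fun r => ∑ a ∈ c.support, c a * (Ioc a s).indicator 1 r :=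
    funext (stepSum_apply c)
  rw [this]
  refine Finset.measurable_fun_sum _ fun a _ => ?_
  exact ((measurable_one.indicator measurableSet_Ioc).const_mul _)

theorem abs_stepSum_le (c : ℝ →₀ ℝ) (r : ℝ) : |stepSum s c r| ≤ ∑ a ∈ c.support, |c a| := by
  rw [stepSum_apply]
  refine (Finset.abs_sum_le_sum_abs _ _).trans (Finset.sum_le_sum fun a _ => ?_)
  rw [abs_mul]
  refine mul_le_of_le_one_right (abs_nonneg _) ?_
  by_cases h : r ∈ Ioc a s <;> simp [h]

theorem memLp_stepSum (c : ℝ →₀ ℝ) (p : ENNReal) :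
    MemLp (stepSum s c) p (volume.restrict (Ioc 0 s)) :=
  MemLp.of_bound (measurable_stepSum c).aestronglyMeasurable _
    (Eventually.of_forall fun r => abs_stepSum_le c r)

theorem integrable_stepSum_sq (c : ℝ →₀ ℝ) (a b : ℝ) :
    IntegrableOn (fun r => stepSum s c r ^ 2) (Ioc a b) := by
  refine Measure.integrableOn_of_bounded (M := (∑ a ∈ c.support, |c a|) ^ 2)
    (by simp) ((measurable_stepSum c).pow_const 2).aestronglyMeasurable ?_
  filter_upwards with r
  rw [norm_pow]
  exact pow_le_pow_left₀ (norm_nonneg _) (abs_stepSum_le c r) 2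

variable {𝓕 : Filtration ℝᵒᵈ mΩ}

theorem stronglyMeasurable_wienerSum (hw : IsBackwardWiener P 𝓕 w s) {b : ℝ} (hb : 0 ≤ b)
    (hbs : b ≤ s) {c : ℝ →₀ ℝ} (hc : c ∈ Finsupp.supported ℝ ℝ (Icc b s)) :
    StronglyMeasurable[𝓕 (toDual b)] (wienerSum w s c) := by
  have : wienerSum w s c = fun ω => ∑ a ∈ c.support, c a • (w a ω - w s ω) :=
    funext (wienerSum_apply c)
  rw [this]
  have key : ∀ a ∈ Icc b s, StronglyMeasurable[𝓕 (toDual b)] (w a) := fun a ha =>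
    (hw.adapted a ⟨hb.trans ha.1, ha.2⟩).mono (𝓕.mono (toDual_le_toDual.2 ha.1))
  refine Finset.stronglyMeasurable_fun_sum _ fun a ha => ?_
  exact StronglyMeasurable.const_smul ((key a (hc ha)).sub (key s ⟨hbs, le_rfl⟩)) (c a)

theorem integral_cexp_incr (hw : IsBackwardWiener P 𝓕 w s) {a b : ℝ} (ha : 0 ≤ a) (hab : a ≤ b)
    (hb : b ≤ s) (x : ℝ) (ξ : EuclideanSpace ℝ (Fin d)) :
    ∫ ω, Complex.exp ((inner ℝ (x • (w a ω - w b ω)) ξ : ℝ) * Complex.I) ∂P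
      = Complex.exp (-(x ^ 2 * (b - a) * ‖ξ‖ ^ 2 / 2 : ℝ)) := by
  have hl := hw.law_incr a b ha hab hb
  have h1 : charFun (P.map fun ω => w a ω - w b ω) (x • ξ)
      = ∫ ω, Complex.exp ((inner ℝ (x • (w a ω - w b ω)) ξ : ℝ) * Complex.I) ∂P := by
    rw [charFun_apply, integral_map hl.aemeasurable (by fun_prop)]
    simp only [real_inner_smul_left, real_inner_smul_right]
  rw [← h1, hl.map_eq, charFun_map_smul, charFun_stdGaussian]
  congr 1
  rw [← Complex.ofReal_pow, norm_smul, norm_smul, mul_pow, mul_pow, Real.norm_eq_abs,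
    Real.norm_eq_abs, sq_abs, sq_abs, Real.sq_sqrt (sub_nonneg.2 hab)]
  push_cast
  ring

/-- Induction on the nodes, adding them in decreasing order: each new node contributes an increment
independent of everything known at the previous node, so characteristic functions multiply and
variances add. -/
theorem isIndepGaussian_wienerSum [IsProbabilityMeasure P] (hw : IsBackwardWiener P 𝓕 w s)
    (hs : 0 ≤ s) {c : ℝ →₀ ℝ} (hc : c ∈ Finsupp.supported ℝ ℝ (Icc 0 s)) :
    IsIndepGaussian P (𝓕 (toDual s)) (wienerSum w s c) (∫ r in Ioc 0 s, stepSum s c r ^ 2) := by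
  -- The time `s` is always admitted as a node. It contributes nothing, and it guarantees that a
  -- node `b` above the smallest one exists.
  suffices H : ∀ S : Finset ℝ, (S : Set ℝ) ⊆ Icc 0 s →
      ∀ c ∈ Finsupp.supported ℝ ℝ (insert s S : Set ℝ),
      IsIndepGaussian P (𝓕 (toDual s)) (wienerSum w s c) (∫ r in Ioc 0 s, stepSum s c r ^ 2) from
    H c.support hc c (fun a ha => Or.inr ha)
  intro S
  induction S using Finset.induction_on_min with
  | empty =>
    intro _ c hc A hA ξ
    have hcs : c = Finsupp.single s (c s) := by
      refine Finsupp.support_subset_singleton.1 fun a ha => ?_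
      simpa using hc ha
    rw [hcs, wienerSum_single, stepSum_single]
    simp
  | insert a S haS ih =>
    intro hS c hc A hA ξ
    have ha : a ∈ Icc 0 s := hS (by simp)
    have hS' : (S : Set ℝ) ⊆ Icc 0 s := fun x hx => hS (by simp [Finset.mem_coe.1 hx])
    obtain ⟨b, hbmem, hbmin⟩ : ∃ b ∈ insert s S, ∀ x ∈ insert s S, b ≤ x :=
      ⟨_, Finset.min'_mem _ (Finset.insert_nonempty s S), fun x hx => Finset.min'_le _ x hx⟩
    have hab : a ≤ b := by
      rcases Finset.mem_insert.1 hbmem with rfl | h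
      · exact ha.2
      · exact (haS b h).le
    have hbs : b ≤ s := hbmin s (by simp)
    have hb0 : 0 ≤ b := ha.1.trans hab
    -- Abel summation: w_a - w_s = (w_a - w_b) + (w_b - w_s), so the mass at `a` is moved to `b` at
    -- the cost of one increment over `(a, b]`.
    set c' : ℝ →₀ ℝ := c.erase a + Finsupp.single b (c a) with hc'
    have hcdec : c = Finsupp.single a (c a) - Finsupp.single b (c a) + c' := by
      rw [hc']
      nth_rewrite 1 [← Finsupp.single_add_erase a c]
      abel
    have hc's : c' ∈ Finsupp.supported ℝ ℝ (insert s S : Set ℝ) := by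
      refine Submodule.add_mem _ ?_ ?_
      · intro x hx
        simp only [Finsupp.support_erase, Finset.coe_erase, Set.mem_sdiff,
          Set.mem_singleton_iff] at hx
        have := hc hx.1
        simp only [Finset.coe_insert, Set.mem_insert_iff] at this ⊢
        tauto
      · refine Finsupp.single_mem_supported ℝ _ ?_
        simpa using hbmem
    have hc'b : c' ∈ Finsupp.supported ℝ ℝ (Icc b s) := by
      refine Finsupp.supported_mono ?_ hc's
      intro x hx
      refine ⟨hbmin x (by simpa using hx), ?_⟩
      rcases hx with rfl | hx
      · exact le_rfl
      · exact (hS' hx).2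
    have hwdec : ∀ ω, wienerSum w s c ω = c a • (w a ω - w b ω) + wienerSum w s c' ω := by
      intro ω
      conv_lhs => rw [hcdec, map_add, map_sub, wienerSum_single, wienerSum_single]
      simp only [Pi.add_apply, Pi.sub_apply, ← smul_sub, sub_sub_sub_cancel_right]
    have hsdec : ∀ r, stepSum s c r = c a * (Ioc a b).indicator 1 r + stepSum s c' r := by
      intro r
      conv_lhs => rw [hcdec, map_add, map_sub, stepSum_single, stepSum_single]
      simp only [Pi.add_apply, Pi.sub_apply, ← mul_sub]
      congr 2
      simp only [indicator, mem_Ioc, Pi.one_apply]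
      split_ifs <;> grind
    have hs0 : ∀ r ≤ b, stepSum s c' r = 0 := by
      intro r hr
      rw [stepSum_apply]
      refine Finset.sum_eq_zero fun x hx => ?_
      have hx' : b ≤ x := (hc'b hx).1
      rw [indicator_of_notMem (fun h => absurd h.1 (not_lt.2 (hr.trans hx'))), mul_zero]
    have hint : ∫ r in Ioc 0 s, stepSum s c r ^ 2
        = c a ^ 2 * (b - a) + ∫ r in Ioc 0 s, stepSum s c' r ^ 2 := by
      have h1 : ∀ r, stepSum s c r ^ 2
          = (Ioc a b).indicator (fun _ => c a ^ 2) r + stepSum s c' r ^ 2 := by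
        intro r
        rw [hsdec]
        by_cases hr : r ∈ Ioc a b
        · simp [hr, hs0 r hr.2]
        · simp [hr]
      simp only [h1]
      rw [integral_add _ (integrable_stepSum_sq c' 0 s), integral_indicator measurableSet_Ioc,
        Measure.restrict_restrict measurableSet_Ioc,
        inter_eq_left.2 (Ioc_subset_Ioc ha.1 hbs), setIntegral_const]
      · simp [Measure.real, hab, mul_comm]
      · exact (integrable_const _).indicator measurableSet_Ioc
    have hih := ih hS' c' (by simpa using hc's) A hA ξ
    have hsb : 𝓕 (toDual s) ≤ 𝓕 (toDual b) := 𝓕.mono (toDual_le_toDual.2 hbs)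
    have hAm : MeasurableSet A := 𝓕.le _ A hA
    -- The event `A` is absorbed into the factor known at time `b`, since 𝓕_s ⊆ 𝓕_b; independence of
    -- the increment then covers `A` as well.
    set U : Ω → ℂ := A.indicator fun ω =>
      Complex.exp ((inner ℝ (wienerSum w s c' ω) ξ : ℝ) * Complex.I) with hU
    set V : Ω → ℂ := fun ω =>
      Complex.exp ((inner ℝ (c a • (w a ω - w b ω)) ξ : ℝ) * Complex.I) with hV
    have hUm : StronglyMeasurable[𝓕 (toDual b)] U := by
      have hcont : Continuous fun y : EuclideanSpace ℝ (Fin d) =>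
        Complex.exp ((inner ℝ y ξ : ℝ) * Complex.I) := by fun_prop
      exact (hcont.comp_stronglyMeasurable
        (stronglyMeasurable_wienerSum hw hb0 hbs hc'b)).indicator (hsb A hA)
    have hwm : ∀ x ∈ Icc 0 s, StronglyMeasurable (w x) := fun x hx =>
      (hw.adapted x hx).mono (𝓕.le _)
    have hcont : Continuous fun y : EuclideanSpace ℝ (Fin d) =>
        Complex.exp ((inner ℝ (c a • y) ξ : ℝ) * Complex.I) := by fun_prop
    have hVm : StronglyMeasurable V := hcont.comp_stronglyMeasurable
      ((hwm a ha).sub (hwm b ⟨hb0, hbs⟩))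
    have hind : IndepFun V U P := by
      have h1 : MeasurableSpace.comap V inferInstance
          ≤ MeasurableSpace.comap (fun ω => w a ω - w b ω) inferInstance := by
        have : V = (fun y : EuclideanSpace ℝ (Fin d) =>
          Complex.exp ((inner ℝ (c a • y) ξ : ℝ) * Complex.I)) ∘ fun ω => w a ω - w b ω := rfl
        rw [this, ← MeasurableSpace.comap_comp]
        exact MeasurableSpace.comap_mono hcont.measurable.comap_le
      have h2 : MeasurableSpace.comap U inferInstance ≤ 𝓕 (toDual b) := hUm.measurable.comap_le
      exact indep_of_indep_of_le_left
        (indep_of_indep_of_le_right (hw.indep_incr a b ha.1 hab hbs) h2) h1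
    have hprod := hind.integral_fun_mul_eq_mul_integral hVm.aestronglyMeasurable
      (hUm.mono (𝓕.le _)).aestronglyMeasurable
    have hVU : ∀ ω, V ω * U ω = A.indicator (fun ω =>
        Complex.exp ((inner ℝ (wienerSum w s c ω) ξ : ℝ) * Complex.I)) ω := by
      intro ω
      by_cases hω : ω ∈ A
      · simp only [hU, hV, indicator_of_mem hω, hwdec, inner_add_left]
        rw [← Complex.exp_add]
        push_cast
        ring_nf
      · simp [hU, hω]
    simp only [hVU] at hprod
    rw [integral_indicator hAm] at hprod
    rw [hprod, hU, integral_indicator hAm, hih, hV, integral_cexp_incr hw ha.1 hab hbs, hint,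
      mul_left_comm, ← Complex.exp_add]
    push_cast
    ring_nf

end Wiener

/-! ### Wiener integrals of deterministic functions and integration by parts. -/

section WienerIntegral

variable {Ω : Type*} {mΩ : MeasurableSpace Ω} {d : ℕ} {P : Measure Ω}
  {w : ℝ → Ω → EuclideanSpace ℝ (Fin d)} {s : ℝ} {𝓕 : Filtration ℝᵒᵈ mΩ}

/-- `J` is the Wiener integral of `φ` over `(0, s]`. Unlike `IsBackwardIntegral`, this notion is
visibly linear in `(φ, J)`. -/
def IsWienerIntegral (P : Measure Ω) (w : ℝ → Ω → EuclideanSpace ℝ (Fin d)) (s : ℝ) (φ : ℝ → ℝ)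
    (J : Ω → EuclideanSpace ℝ (Fin d)) : Prop :=
  AEStronglyMeasurable φ (volume.restrict (Ioc 0 s)) ∧ AEStronglyMeasurable J P ∧
  ∃ C : ℕ → ℝ →₀ ℝ, (∀ k, C k ∈ Finsupp.supported ℝ ℝ (Icc 0 s)) ∧
    Tendsto (fun k => eLpNorm (stepSum s (C k) - φ) 2 (volume.restrict (Ioc 0 s))) atTop (𝓝 0) ∧
    Tendsto (fun k => eLpNorm (wienerSum w s (C k) - J) 2 P) atTop (𝓝 0)

theorem tendsto_eLpNorm_add_zero {α F : Type*} [MeasurableSpace α] [NormedAddCommGroup F]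
    {μ : Measure α} {a b : ℕ → α → F} (ha : ∀ k, AEStronglyMeasurable (a k) μ)
    (hb : ∀ k, AEStronglyMeasurable (b k) μ)
    (ha' : Tendsto (fun k => eLpNorm (a k) 2 μ) atTop (𝓝 0))
    (hb' : Tendsto (fun k => eLpNorm (b k) 2 μ) atTop (𝓝 0)) :
    Tendsto (fun k => eLpNorm (a k + b k) 2 μ) atTop (𝓝 0) := by
  have := ha'.add hb'
  rw [add_zero] at this
  exact tendsto_of_tendsto_of_tendsto_of_le_of_le tendsto_const_nhds this (fun _ => zero_le)
    fun k => eLpNorm_add_le (ha k) (hb k) (by norm_num)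

theorem aestronglyMeasurable_wienerSum (hw : IsBackwardWiener P 𝓕 w s) (hs : 0 ≤ s) {c : ℝ →₀ ℝ}
    (hc : c ∈ Finsupp.supported ℝ ℝ (Icc 0 s)) : AEStronglyMeasurable (wienerSum w s c) P :=
  ((stronglyMeasurable_wienerSum hw le_rfl hs hc).mono (𝓕.le _)).aestronglyMeasurable

theorem IsWienerIntegral.add (hw : IsBackwardWiener P 𝓕 w s) (hs : 0 ≤ s) {φ ψ : ℝ → ℝ}
    {J K : Ω → EuclideanSpace ℝ (Fin d)} (hJ : IsWienerIntegral P w s φ J)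
    (hK : IsWienerIntegral P w s ψ K) : IsWienerIntegral P w s (φ + ψ) (J + K) := by
  obtain ⟨h1, h2, C, hC, h3, h4⟩ := hJ
  obtain ⟨k1, k2, D, hD, k3, k4⟩ := hK
  refine ⟨h1.add k1, h2.add k2, fun k => C k + D k, fun k => Submodule.add_mem _ (hC k) (hD k),
    ?_, ?_⟩
  · have := tendsto_eLpNorm_add_zero
      (fun k => (measurable_stepSum (C k)).aestronglyMeasurable.sub h1)
      (fun k => (measurable_stepSum (D k)).aestronglyMeasurable.sub k1) h3 k3
    simpa only [map_add, add_sub_add_comm] using this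
  · have := tendsto_eLpNorm_add_zero
      (fun k => (aestronglyMeasurable_wienerSum hw hs (hC k)).sub h2)
      (fun k => (aestronglyMeasurable_wienerSum hw hs (hD k)).sub k2) h4 k4
    simpa only [map_add, add_sub_add_comm] using this

theorem IsWienerIntegral.const_smul {φ : ℝ → ℝ}
    {J : Ω → EuclideanSpace ℝ (Fin d)} (hJ : IsWienerIntegral P w s φ J) (x : ℝ) :
    IsWienerIntegral P w s (x • φ) (x • J) := by
  obtain ⟨h1, h2, C, hC, h3, h4⟩ := hJ
  refine ⟨h1.const_smul x, h2.const_smul x, fun k => x • C k,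
    fun k => Submodule.smul_mem _ _ (hC k), ?_, ?_⟩
  · simp only [map_smul, ← smul_sub, eLpNorm_const_smul]
    simpa using ENNReal.Tendsto.const_mul h3 (Or.inr enorm_ne_top)
  · simp only [map_smul, ← smul_sub, eLpNorm_const_smul]
    simpa using ENNReal.Tendsto.const_mul h4 (Or.inr enorm_ne_top)

theorem IsWienerIntegral.sum (hw : IsBackwardWiener P 𝓕 w s) (hs : 0 ≤ s) {ι : Type*}
    (I : Finset ι) {φ : ι → ℝ → ℝ} {J : ι → Ω → EuclideanSpace ℝ (Fin d)}
    (hJ : ∀ i ∈ I, IsWienerIntegral P w s (φ i) (J i)) :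
    IsWienerIntegral P w s (∑ i ∈ I, φ i) (∑ i ∈ I, J i) := by
  classical
  induction I using Finset.induction_on with
  | empty =>
    exact ⟨aestronglyMeasurable_const, aestronglyMeasurable_const, fun _ => 0,
      fun _ => Submodule.zero_mem _, by simp, by simp⟩
  | insert i I hi ih =>
    rw [Finset.sum_insert hi, Finset.sum_insert hi]
    exact (hJ i (by simp)).add hw hs (ih fun j hj => hJ j (by simp [hj]))

/-- Convergence in L²(P) gives an almost surely convergent subsequence of step integrals, while
convergence in L²(0, s) makes their variances converge. -/
theorem IsWienerIntegral.isIndepGaussian [IsProbabilityMeasure P] (hw : IsBackwardWiener P 𝓕 w s)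
    (hs : 0 ≤ s) {φ : ℝ → ℝ} {J : Ω → EuclideanSpace ℝ (Fin d)}
    (hJ : IsWienerIntegral P w s φ J) :
    IsIndepGaussian P (𝓕 (toDual s)) J (∫ r in Ioc 0 s, φ r ^ 2) := by
  obtain ⟨h1, h2, C, hC, h3, h4⟩ := hJ
  -- Square integrability is not part of the definition: it follows because some bounded approximant
  -- lies at finite L² distance.
  have hφ : MemLp φ 2 (volume.restrict (Ioc 0 s)) := by
    obtain ⟨k, hk⟩ := ((tendsto_order.1 h3).2 1 one_pos).exists
    have hd : MemLp (stepSum s (C k) - φ) 2 (volume.restrict (Ioc 0 s)) :=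
      ⟨(measurable_stepSum (C k)).aestronglyMeasurable.sub h1, hk.trans ENNReal.one_lt_top⟩
    simpa using (memLp_stepSum (C k) 2).sub hd
  have hsq : ∀ {f : ℝ → ℝ} (hf : MemLp f 2 (volume.restrict (Ioc 0 s))),
      ‖hf.toLp f‖ ^ 2 = ∫ r in Ioc 0 s, f r ^ 2 := by
    intro f hf
    rw [← real_inner_self_eq_norm_sq, L2.inner_def]
    refine integral_congr_ae ?_
    filter_upwards [hf.coeFn_toLp] with r hr
    rw [hr]
    simp [pow_two]
  have hnorm : Tendsto (fun k => ∫ r in Ioc 0 s, stepSum s (C k) r ^ 2) atTop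
      (𝓝 (∫ r in Ioc 0 s, φ r ^ 2)) := by
    have := (Lp.tendsto_Lp_iff_tendsto_eLpNorm'' _ (fun k => memLp_stepSum (C k) 2) φ hφ).2 h3
    simpa only [hsq] using (this.norm.pow 2)
  have hmeas := fun k => aestronglyMeasurable_wienerSum hw hs (hC k)
  obtain ⟨ns, hns, hae⟩ := (tendstoInMeasure_of_tendsto_eLpNorm two_ne_zero hmeas h2
    h4).exists_seq_tendsto_ae
  exact IsIndepGaussian.of_tendsto_ae (fun n => isIndepGaussian_wienerSum hw hs (hC (ns n)))
    (fun n => hmeas (ns n)) hae (hnorm.comp hns.tendsto_atTop)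

theorem IsBackwardIntegral.isWienerIntegral {g : ℝ → ℝ} {t : ℝ}
    {J : Ω → EuclideanSpace ℝ (Fin d)} (hJ : IsBackwardIntegral P w g s t J) (ht : 0 ≤ t) :
    IsWienerIntegral P w s ((Ioc t s).indicator g) J := by
  obtain ⟨h1, h2, Φ, h3, h4⟩ := hJ
  have hsub : Ioc t s ⊆ Ioc 0 s := Ioc_subset_Ioc_left ht
  have hnode : ∀ k, ∀ i ≤ (Φ k).n, (Φ k).node i ∈ Icc t s := fun k i hi =>
    ⟨(Φ k).node_zero.symm.le.trans ((Φ k).mono (Nat.zero_le i)),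
      ((Φ k).mono hi).trans (Φ k).node_last.le⟩
  -- Each indicator of `(rᵢ, rᵢ₊₁]` is the difference of those of `(rᵢ, s]` and `(rᵢ₊₁, s]`.
  set C : ℕ → ℝ →₀ ℝ := fun k => ∑ i ∈ Finset.range (Φ k).n, (Φ k).val i •
    (Finsupp.single ((Φ k).node i) 1 - Finsupp.single ((Φ k).node (i + 1)) 1) with hC
  have hCw : ∀ k ω, wienerSum w s (C k) ω = (Φ k).integral w ω := by
    intro k ω
    simp only [hC, map_sum, map_smul, map_sub, wienerSum_single, StepFn.integral,
      Finset.sum_apply, Pi.smul_apply, Pi.sub_apply, one_smul, sub_sub_sub_cancel_right]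
  have hCs : ∀ k r, stepSum s (C k) r = (Φ k).eval r := by
    intro k r
    simp only [hC, map_sum, map_smul, map_sub, stepSum_single, StepFn.eval,
      Finset.sum_apply, Pi.smul_apply, Pi.sub_apply, one_mul, smul_eq_mul]
    refine Finset.sum_congr rfl fun i hi => ?_
    have hi' := Finset.mem_range.1 hi
    have ha := (Φ k).mono (Nat.le_succ i)
    have hb := (hnode k (i + 1) hi').2
    simp only [indicator, mem_Ioc, Pi.one_apply, Nat.succ_eq_add_one] at ha ⊢
    split_ifs <;> grind
  have hE : ∀ k, ∀ r ∉ Ioc t s, (Φ k).eval r = 0 := by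
    intro k r hr
    refine Finset.sum_eq_zero fun i hi => ?_
    have hi' := Finset.mem_range.1 hi
    refine indicator_of_notMem (fun h => hr ?_) _
    exact ⟨(hnode k i hi'.le).1.trans_lt h.1, h.2.trans (hnode k (i + 1) hi').2⟩
  refine ⟨?_, h2, C, ?_, ?_, ?_⟩
  · exact ((aestronglyMeasurable_indicator_iff measurableSet_Ioc).2 h1).restrict
  · intro k
    refine Submodule.sum_mem _ fun i hi => Submodule.smul_mem _ _ (Submodule.sub_mem _ ?_ ?_)
    all_goals
      have hi' := Finset.mem_range.1 hi
      refine Finsupp.single_mem_supported ℝ _ (Icc_subset_Icc_left ht ?_)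
    · exact hnode k i hi'.le
    · exact hnode k (i + 1) hi'
  · have : ∀ k, stepSum s (C k) - (Ioc t s).indicator g
        = (Ioc t s).indicator fun r => (Φ k).eval r - g r := by
      intro k
      ext r
      by_cases hr : r ∈ Ioc t s
      · simp [hr, hCs]
      · simp [hr, hCs, hE k r hr]
    simp only [this, eLpNorm_indicator_eq_eLpNorm_restrict measurableSet_Ioc,
      Measure.restrict_restrict measurableSet_Ioc, inter_eq_left.2 hsub]
    exact h3
  · have : ∀ k, wienerSum w s (C k) - J = fun ω => (Φ k).integral w ω - J ω := fun k =>
      funext fun ω => by rw [Pi.sub_apply, hCw]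
    simpa only [this] using h4

/-- Grouping by the finitely many values of `κ` turns a time integral into a finite combination of
the `J v` with deterministic coefficients. No regularity of `J` is required. -/
theorem setIntegral_smul_comp_simpleFunc {F : Type*} [NormedAddCommGroup F] [NormedSpace ℝ F]
    [CompleteSpace F] {q : ℝ → ℝ} {B : Set ℝ} (hq : IntegrableOn q B) (κ : SimpleFunc ℝ ℝ)
    (J : ℝ → F) :
    ∫ u in B, q u • J (κ u)
      = ∑ v ∈ κ.range, (∫ u in B, (κ ⁻¹' {v}).indicator q u) • J v := by
  have h1 : ∀ u, q u • J (κ u) = ∑ v ∈ κ.range, (κ ⁻¹' {v}).indicator q u • J v := by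
    intro u
    rw [Finset.sum_eq_single (κ u)]
    · simp
    · intro v _ hv
      rw [indicator_of_notMem (by simpa using hv.symm), zero_smul]
    · intro h
      exact absurd (κ.mem_range_self u) h
  simp only [h1]
  rw [integral_finsetSum]
  · simp only [integral_smul_const]
  · intro v _
    exact (hq.indicator (κ.measurableSet_fiber v)).smul_const _

/-- Integration by parts `∫_s^t m dJ = m_t J_t + ∫_t^s J dm` turns a family of Wiener integrals
with integrand `g` into the Wiener integral with integrand `m g`. -/
theorem isIndepGaussian_integral_by_parts [IsProbabilityMeasure P]
    (hw : IsBackwardWiener P 𝓕 w s) {t : ℝ} (ht : 0 ≤ t) (hts : t ≤ s) {g q : ℝ → ℝ} {x : ℝ}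
    {J : ℝ → Ω → EuclideanSpace ℝ (Fin d)}
    (hJ : ∀ r ∈ Icc t s, IsWienerIntegral P w s ((Ioc r s).indicator g) (J r))
    (hcont : ∀ᵐ ω ∂P, ContinuousOn (fun r => J r ω) (Icc t s))
    (hg : IntegrableOn (fun r => g r ^ 2) (Ioc t s)) (hq : IntegrableOn q (Ioc t s)) :
    AEStronglyMeasurable (fun ω => x • J t ω + ∫ u in Ioc t s, q u • J u ω) P ∧
    IsIndepGaussian P (𝓕 (toDual s)) (fun ω => x • J t ω + ∫ u in Ioc t s, q u • J u ω)
      (∫ r in Ioc t s, (g r * (x + ∫ u in Ioc t r, q u)) ^ 2) := by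
  have hs : 0 ≤ s := ht.trans hts
  have htm : t ∈ Icc t s := ⟨le_rfl, hts⟩
  -- Simple functions approximating the identity discretise time: J_u is replaced by J at `κ n u`,
  -- and path continuity recovers J_u in the limit.
  set κ : ℕ → SimpleFunc ℝ ℝ := SimpleFunc.approxOn id measurable_id (Icc t s) t htm with hκ
  have hκm : ∀ n u, κ n u ∈ Icc t s := fun n u => SimpleFunc.approxOn_mem measurable_id htm n u
  have hκl : ∀ u ∈ Icc t s, Tendsto (fun n => κ n u) atTop (𝓝 u) := fun u hu =>
    SimpleFunc.tendsto_approxOn measurable_id htm (subset_closure hu)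
  set c : ℕ → ℝ → ℝ := fun n v => ∫ u in Ioc t s, (κ n ⁻¹' {v}).indicator q u with hc
  set N : ℕ → Ω → EuclideanSpace ℝ (Fin d) := fun n =>
    x • J t + ∑ v ∈ (κ n).range, c n v • J v with hN
  set φ : ℕ → ℝ → ℝ := fun n => x • (Ioc t s).indicator g
    + ∑ v ∈ (κ n).range, c n v • (Ioc v s).indicator g with hφ
  have hW : ∀ n, IsWienerIntegral P w s (φ n) (N n) := by
    intro n
    refine ((hJ t htm).const_smul x).add hw hs (IsWienerIntegral.sum hw hs _ fun v hv => ?_)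
    obtain ⟨u, rfl⟩ := SimpleFunc.mem_range.1 hv
    exact (hJ _ (hκm n u)).const_smul _
  have hNeq : ∀ n ω, N n ω = x • J t ω + ∫ u in Ioc t s, q u • J (κ n u) ω := by
    intro n ω
    rw [setIntegral_smul_comp_simpleFunc hq (κ n) fun v => J v ω]
    simp [hN, hc]
  -- The noise at time r enters exactly those J_v with v < r, so its discretised weight is `x` plus
  -- the integral of `q` over the u with `κ n u < r`.
  have hφeq : ∀ n, φ n = (Ioc t s).indicator fun r =>
      g r * (x + ∫ u in Ioc t s, q u • (Iio r).indicator (1 : ℝ → ℝ) (κ n u)) := by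
    intro n
    ext r
    simp only [indicator_apply (Ioc t s)]
    rw [setIntegral_smul_comp_simpleFunc hq (κ n) fun v => (Iio r).indicator (1 : ℝ → ℝ) v]
    simp only [hφ, Pi.add_apply, Pi.smul_apply, Finset.sum_apply, smul_eq_mul]
    by_cases hr : r ∈ Ioc t s
    · rw [if_pos hr, indicator_of_mem hr, mul_add, Finset.mul_sum, mul_comm x]
      congr 1
      refine Finset.sum_congr rfl fun v _ => ?_
      by_cases hv : v < r
      · rw [indicator_of_mem (show r ∈ Ioc v s from ⟨hv, hr.2⟩),
          indicator_of_mem (show v ∈ Iio r from hv)]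
        simp [hc, mul_comm]
      · rw [indicator_of_notMem (fun h => hv h.1), indicator_of_notMem (show v ∉ Iio r from hv)]
        simp
    · rw [if_neg hr, indicator_of_notMem hr, mul_zero, zero_add]
      refine Finset.sum_eq_zero fun v hv => ?_
      obtain ⟨u, rfl⟩ := SimpleFunc.mem_range.1 hv
      rw [indicator_of_notMem (fun h => hr ⟨(hκm n u).1.trans_lt h.1, h.2⟩), mul_zero]
  have hNlim : ∀ᵐ ω ∂P, Tendsto (fun n => N n ω) atTop
      (𝓝 (x • J t ω + ∫ u in Ioc t s, q u • J u ω)) := by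
    filter_upwards [hcont] with ω hω
    simp only [hNeq]
    refine tendsto_const_nhds.add ?_
    obtain ⟨B, hB⟩ := isCompact_Icc.exists_bound_of_continuousOn hω
    refine tendsto_integral_of_dominated_convergence (fun u => ‖q u‖ * B) ?_ ?_ ?_ ?_
    · intro n
      refine hq.aestronglyMeasurable.smul ?_
      exact ((κ n).map fun v => J v ω).aestronglyMeasurable
    · exact hq.norm.mul_const B
    · intro n
      filter_upwards with u
      rw [norm_smul]
      exact mul_le_mul_of_nonneg_left (hB _ (hκm n u)) (norm_nonneg _)
    · filter_upwards [ae_restrict_mem measurableSet_Ioc] with u hu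
      have hu' := Ioc_subset_Icc_self hu
      refine Tendsto.const_smul ?_ _
      exact (hω u hu').tendsto.comp (tendsto_nhdsWithin_iff.2
        ⟨hκl u hu', Eventually.of_forall fun n => hκm n u⟩)
  have hinner : ∀ r ∈ Ioc t s, Tendsto
      (fun n => ∫ u in Ioc t s, q u • (Iio r).indicator (1 : ℝ → ℝ) (κ n u)) atTop
      (𝓝 (∫ u in Ioc t r, q u)) := by
    intro r hr
    have h1 : ∫ u in Ioc t r, q u
        = ∫ u in Ioc t s, q u • (Iio r).indicator (1 : ℝ → ℝ) u := by
      have h2 : ∀ u, q u • (Iio r).indicator (1 : ℝ → ℝ) u = (Iio r).indicator q u := by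
        intro u
        by_cases hu : u ∈ Iio r <;> simp [hu]
      simp only [h2]
      rw [setIntegral_indicator measurableSet_Iio, integral_Ioc_eq_integral_Ioo]
      congr 2
      ext u
      simp only [mem_Ioo, mem_inter_iff, mem_Ioc, mem_Iio]
      constructor
      · exact fun h => ⟨⟨h.1, h.2.le.trans hr.2⟩, h.2⟩
      · exact fun h => ⟨h.1.1, h.2⟩
    rw [h1]
    refine tendsto_integral_of_dominated_convergence (fun u => ‖q u‖) ?_ hq.norm ?_ ?_
    · intro n
      refine hq.aestronglyMeasurable.smul ?_
      exact ((κ n).map fun v => (Iio r).indicator (1 : ℝ → ℝ) v).aestronglyMeasurable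
    · intro n
      filter_upwards with u
      rw [norm_smul]
      refine mul_le_of_le_one_right (norm_nonneg _) ?_
      by_cases hu : κ n u ∈ Iio r <;> simp [hu]
    -- The indicator of `Iio r` jumps only at `r`, a null set.
    · have hne : ∀ᵐ u ∂(volume.restrict (Ioc t s)), u ≠ r :=
        ae_restrict_of_ae (by simp [ae_iff])
      filter_upwards [ae_restrict_mem measurableSet_Ioc, hne] with u hu hur
      refine Tendsto.const_smul ?_ _
      have hl := hκl u (Ioc_subset_Icc_self hu)
      refine tendsto_const_nhds.congr' ?_
      rcases lt_or_gt_of_ne hur with h | h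
      · filter_upwards [hl.eventually (isOpen_Iio.mem_nhds h)] with n hn
        rw [indicator_of_mem (show u ∈ Iio r from h), indicator_of_mem (show κ n u ∈ Iio r from hn)]
        rfl
      · filter_upwards [hl.eventually (isOpen_Ioi.mem_nhds h)] with n hn
        rw [indicator_of_notMem (show u ∉ Iio r from not_lt.2 h.le),
          indicator_of_notMem (show κ n u ∉ Iio r from not_lt.2 (le_of_lt hn))]
  have hbound : ∀ n r, |x + ∫ u in Ioc t s, q u • (Iio r).indicator (1 : ℝ → ℝ) (κ n u)|
      ≤ |x| + ∫ u in Ioc t s, ‖q u‖ := by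
    intro n r
    refine (abs_add_le _ _).trans (add_le_add le_rfl ?_)
    rw [← Real.norm_eq_abs]
    refine norm_integral_le_of_norm_le hq.norm ?_
    filter_upwards with u
    rw [norm_smul]
    refine mul_le_of_le_one_right (norm_nonneg _) ?_
    by_cases hu : κ n u ∈ Iio r <;> simp [hu]
  have hvar : Tendsto (fun n => ∫ r in Ioc 0 s, φ n r ^ 2) atTop
      (𝓝 (∫ r in Ioc t s, (g r * (x + ∫ u in Ioc t r, q u)) ^ 2)) := by
    have hsub : Ioc t s ⊆ Ioc 0 s := Ioc_subset_Ioc_left ht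
    have h1 : ∀ n, ∫ r in Ioc 0 s, φ n r ^ 2 = ∫ r in Ioc t s, φ n r ^ 2 := by
      intro n
      refine (setIntegral_eq_of_subset_of_forall_sdiff_eq_zero measurableSet_Ioc hsub ?_)
      intro r hr
      rw [hφeq, indicator_of_notMem hr.2]
      simp
    simp only [h1]
    refine tendsto_integral_of_dominated_convergence
      (fun r => g r ^ 2 * (|x| + ∫ u in Ioc t s, ‖q u‖) ^ 2) ?_ (hg.mul_const _) ?_ ?_
    · exact fun n => ((hW n).1.mono_set hsub).pow 2
    · intro n
      filter_upwards [ae_restrict_mem measurableSet_Ioc] with r hr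
      rw [hφeq, indicator_of_mem hr, norm_pow, norm_mul, mul_pow, Real.norm_eq_abs, sq_abs]
      exact mul_le_mul_of_nonneg_left (pow_le_pow_left₀ (norm_nonneg _) (hbound n r) 2)
        (sq_nonneg _)
    · filter_upwards [ae_restrict_mem measurableSet_Ioc] with r hr
      simp only [hφeq, indicator_of_mem hr]
      exact (((hinner r hr).const_add x).const_mul (g r)).pow 2
  exact ⟨aestronglyMeasurable_of_tendsto_ae _ (fun n => (hW n).2.1) hNlim,
    IsIndepGaussian.of_tendsto_ae (fun n => (hW n).isIndepGaussian hw hs) (fun n => (hW n).2.1)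
      hNlim hvar⟩

end WienerIntegral

/-! ### Calculus of the noise schedule. -/

namespace Schedule

variable {T : ℝ} {S : Schedule T} {s : ℝ}

/-- The starting times of the reverse-time SDE for which all coefficients are nondegenerate. -/
structure IsStart (S : Schedule T) (s : ℝ) : Prop where
  pos : 0 < s
  le_T : s ≤ T
  α_pos : 0 < S.α s
  η_lt_one : S.η s < 1
  σ_pos : ∀ t ∈ Ioc 0 s, 0 < S.σ t

/-- The coefficient `α_t (1 - η_t)`. -/
def scale (S : Schedule T) (t : ℝ) : ℝ := S.α t * (1 - S.η t)

/-- The integrating factor `α_t (1 - η_t) / σ_t²` of the linear part of the SDE. -/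
def factor (S : Schedule T) (t : ℝ) : ℝ := S.scale t / S.σ t ^ 2

/-- The rate of change of `-1 / λ²`. -/
def rate (S : Schedule T) (t : ℝ) : ℝ := S.factor t ^ 2 * S.g t ^ 2

/-- The derivative of the integrating factor. -/
def factorDeriv (S : Schedule T) (t : ℝ) : ℝ :=
  -((S.f t + S.g t ^ 2 / S.σ t ^ 2) * S.factor t)

/-- The coefficient of the noise in the closed form. -/
def noiseCoeff (S : Schedule T) (s t : ℝ) : ℝ :=
  S.α t * (1 - S.η t) * √(S.lam t ^ 2 - S.lam t ^ 4 / S.lam s ^ 2)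

namespace IsStart

theorem Icc_subset (hS : S.IsStart s) : Icc 0 s ⊆ Icc 0 T := Icc_subset_Icc_right hS.le_T

theorem s_mem (hS : S.IsStart s) : s ∈ Icc 0 s := ⟨hS.pos.le, le_rfl⟩

theorem α_pos_of_mem (hS : S.IsStart s) {t : ℝ} (ht : t ∈ Icc 0 s) : 0 < S.α t :=
  hS.α_pos.trans_le (S.α_anti (hS.Icc_subset ht) (hS.Icc_subset hS.s_mem) ht.2)

theorem α_le_one (hS : S.IsStart s) {t : ℝ} (ht : t ∈ Icc 0 s) : S.α t ≤ 1 := by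
  nlinarith [S.sq_add_sq t (hS.Icc_subset ht), sq_nonneg (S.σ t), hS.α_pos_of_mem ht]

theorem η_le (hS : S.IsStart s) {t : ℝ} (ht : t ∈ Icc 0 s) : S.η t ≤ S.η s :=
  S.η_mono (hS.Icc_subset ht) (hS.Icc_subset hS.s_mem) ht.2

theorem η_lt_one_of_mem (hS : S.IsStart s) {t : ℝ} (ht : t ∈ Icc 0 s) : S.η t < 1 :=
  (hS.η_le ht).trans_lt hS.η_lt_one

theorem scale_pos (hS : S.IsStart s) {t : ℝ} (ht : t ∈ Icc 0 s) : 0 < S.scale t :=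
  mul_pos (hS.α_pos_of_mem ht) (sub_pos.2 (hS.η_lt_one_of_mem ht))

theorem scale_antitoneOn (hS : S.IsStart s) : AntitoneOn S.scale (Icc 0 s) := by
  intro t ht u hu htu
  refine mul_le_mul (S.α_anti (hS.Icc_subset ht) (hS.Icc_subset hu) htu) ?_ ?_ ?_
  · have := S.η_mono (hS.Icc_subset ht) (hS.Icc_subset hu) htu
    linarith
  · exact (sub_pos.2 (hS.η_lt_one_of_mem hu)).le
  · exact (hS.α_pos_of_mem ht).le

theorem σ_sq (hS : S.IsStart s) {t : ℝ} (ht : t ∈ Icc 0 s) : S.σ t ^ 2 = 1 - S.α t ^ 2 := by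
  linarith [S.sq_add_sq t (hS.Icc_subset ht)]

theorem σ_nonneg (hS : S.IsStart s) {t : ℝ} (ht : t ∈ Icc 0 s) : 0 ≤ S.σ t :=
  S.σ_nonneg t (hS.Icc_subset ht)

theorem σ_monotoneOn (hS : S.IsStart s) : MonotoneOn S.σ (Icc 0 s) := by
  intro t ht u hu htu
  refine le_of_sq_le_sq ?_ (hS.σ_nonneg hu)
  rw [hS.σ_sq ht, hS.σ_sq hu]
  have := S.α_anti (hS.Icc_subset ht) (hS.Icc_subset hu) htu
  nlinarith [hS.α_pos_of_mem ht, hS.α_pos_of_mem hu]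

theorem lam_monotoneOn (hS : S.IsStart s) : MonotoneOn S.lam (Icc 0 s) := fun _ ht _ hu htu =>
  div_le_div₀ (hS.σ_nonneg hu) (hS.σ_monotoneOn ht hu htu) (hS.scale_pos hu)
    (hS.scale_antitoneOn ht hu htu)

theorem lam_pos (hS : S.IsStart s) {t : ℝ} (ht : t ∈ Icc 0 s) (hσ : 0 < S.σ t) : 0 < S.lam t :=
  div_pos hσ (hS.scale_pos ht)

theorem α_continuousOn (hS : S.IsStart s) : ContinuousOn S.α (Icc 0 s) :=
  S.α_diff.continuousOn.mono hS.Icc_subset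

theorem η_continuousOn (hS : S.IsStart s) : ContinuousOn S.η (Icc 0 s) :=
  S.η_diff.continuousOn.mono hS.Icc_subset

theorem σ_continuousOn (hS : S.IsStart s) : ContinuousOn S.σ (Icc 0 s) := by
  have h : ContinuousOn (fun t => √(1 - S.α t ^ 2)) (Icc 0 s) :=
    (continuousOn_const.sub (hS.α_continuousOn.pow 2)).sqrt
  refine h.congr fun t ht => ?_
  beta_reduce
  rw [← hS.σ_sq ht, Real.sqrt_sq (hS.σ_nonneg ht)]

theorem scale_continuousOn (hS : S.IsStart s) : ContinuousOn S.scale (Icc 0 s) :=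
  hS.α_continuousOn.mul (continuousOn_const.sub hS.η_continuousOn)

theorem lam_continuousOn (hS : S.IsStart s) : ContinuousOn S.lam (Icc 0 s) :=
  hS.σ_continuousOn.div hS.scale_continuousOn fun _ ht => (hS.scale_pos ht).ne'

/-- The formula for g² requires a nonnegative radicand, as the real square root is zero on negative
numbers. Monotonicity of α and η provides this through α' ≤ 0 and f ≤ 0. -/
theorem exists_deriv (hS : S.IsStart s) {r : ℝ} (hr : r ∈ Ioo 0 s) :
    ∃ a e : ℝ, HasDerivAt S.α a r ∧ HasDerivAt S.η e r ∧ a ≤ 0 ∧ 0 ≤ e ∧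
      a = derivWithin S.α (Icc 0 T) r ∧ e = derivWithin S.η (Icc 0 T) r ∧
      S.f r = a / S.α r - e / (1 - S.η r) ∧ S.h r = S.α r / (1 - S.η r) * e ∧
      S.g r ^ 2 = -2 * S.α r * a - 2 * S.f r * S.σ r ^ 2 := by
  have hnhds : Icc 0 T ∈ 𝓝 r := Icc_mem_nhds hr.1 (hr.2.trans_le hS.le_T)
  have hrs : r ∈ Icc 0 s := Ioo_subset_Icc_self hr
  have hrT := hS.Icc_subset hrs
  have hα := (S.α_diff r hrT).hasDerivWithinAt.hasDerivAt hnhds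
  have hη := (S.η_diff r hrT).hasDerivWithinAt.hasDerivAt hnhds
  have hα0 := hS.α_pos_of_mem hrs
  have hη0 := sub_pos.2 (hS.η_lt_one_of_mem hrs)
  set a := derivWithin S.α (Icc 0 T) r with ha
  set e := derivWithin S.η (Icc 0 T) r with he
  have ha0 : a ≤ 0 := S.α_anti.derivWithin_nonpos
  have he0 : 0 ≤ e := S.η_mono.derivWithin_nonneg
  have hf : S.f r = a / S.α r - e / (1 - S.η r) := by
    rw [Schedule.f, derivWithin_of_mem_nhds hnhds]
    have := ((hα.mul (hη.const_sub 1)).log (mul_pos hα0 hη0).ne').deriv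
    refine this.trans ?_
    simp only [Pi.mul_apply]
    field_simp
    ring
  have hg : derivWithin (fun u => S.σ u ^ 2) (Icc 0 T) r = -2 * S.α r * a := by
    have h1 : (fun u => S.σ u ^ 2) =ᶠ[𝓝 r] fun u => 1 - S.α u ^ 2 := by
      filter_upwards [hnhds] with u hu
      linarith [S.sq_add_sq u hu]
    rw [derivWithin_of_mem_nhds hnhds, h1.deriv_eq]
    refine ((hα.pow 2).const_sub 1).deriv.trans ?_
    ring
  refine ⟨a, e, hα, hη, ha0, he0, rfl, rfl, hf, rfl, ?_⟩
  rw [Schedule.g, hg, Real.sq_sqrt]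
  have h1 : S.f r ≤ 0 := by
    rw [hf]
    have h2 := div_nonpos_of_nonpos_of_nonneg ha0 hα0.le
    have h3 := div_nonneg he0 hη0.le
    linarith
  nlinarith [mul_nonneg hα0.le (neg_nonneg.2 ha0), mul_nonneg (neg_nonneg.2 h1) (sq_nonneg (S.σ r))]

/-- On `[0, s]` both α and 1-η are bounded below by their positive values at `s`. The bound on g²
persists where σ tends to 0, since (σ²)' = -2αα'. -/
theorem exists_bound (hS : S.IsStart s) :
    ∃ K, ∀ r ∈ Ioo 0 s, |S.f r| ≤ K ∧ S.g r ^ 2 ≤ K ∧ |S.h r| ≤ K := by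
  obtain ⟨A, hA⟩ := S.α_deriv_bdd
  obtain ⟨B, hB⟩ := S.η_deriv_bdd
  have hα0 := hS.α_pos
  have hη0 := sub_pos.2 hS.η_lt_one
  have hA0 : 0 ≤ A := (abs_nonneg _).trans (hA s (hS.Icc_subset hS.s_mem))
  have hB0 : 0 ≤ B := (abs_nonneg _).trans (hB s (hS.Icc_subset hS.s_mem))
  set F := A / S.α s + B / (1 - S.η s) with hF
  have hF0 : 0 ≤ F := by positivity
  have hfb : ∀ r ∈ Ioo 0 s, |S.f r| ≤ F := by
    intro r hr
    have hrs := Ioo_subset_Icc_self hr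
    obtain ⟨a, e, -, -, -, -, ha, he, hf, -, -⟩ := hS.exists_deriv hr
    have hr1 := hS.α_pos_of_mem hrs
    have hr2 := sub_pos.2 (hS.η_lt_one_of_mem hrs)
    rw [hf]
    refine (abs_sub _ _).trans (add_le_add ?_ ?_)
    · rw [abs_div, abs_of_pos hr1, ha]
      exact div_le_div₀ hA0 (hA r (hS.Icc_subset hrs)) hα0
        (S.α_anti (hS.Icc_subset hrs) (hS.Icc_subset hS.s_mem) hrs.2)
    · rw [abs_div, abs_of_pos hr2, he]
      exact div_le_div₀ hB0 (hB r (hS.Icc_subset hrs)) hη0 (by linarith [hS.η_le hrs])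
  refine ⟨F + (2 * A + 2 * F) + 1 / (1 - S.η s) * B, fun r hr => ?_⟩
  have hrs := Ioo_subset_Icc_self hr
  obtain ⟨a, e, -, -, ha0, he0, ha, he, hf, hh, hg⟩ := hS.exists_deriv hr
  have hr1 := hS.α_pos_of_mem hrs
  have hr2 := sub_pos.2 (hS.η_lt_one_of_mem hrs)
  have hr3 := hS.α_le_one hrs
  have hG0 : 0 ≤ 2 * A + 2 * F := by positivity
  have hH0 : 0 ≤ 1 / (1 - S.η s) * B := by positivity
  have haA : -a ≤ A := by
    have := hA r (hS.Icc_subset hrs)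
    rw [← ha] at this
    exact (neg_le_abs a).trans this
  have hfF := hfb r hr
  refine ⟨by linarith, ?_, ?_⟩
  · have hσ1 : S.σ r ^ 2 ≤ 1 := by rw [hS.σ_sq hrs]; nlinarith
    have h1 : S.α r * -a ≤ A := by nlinarith
    have h2 : -S.f r * S.σ r ^ 2 ≤ F := by
      have h3 := neg_le_abs (S.f r)
      nlinarith [sq_nonneg (S.σ r), abs_nonneg (S.f r)]
    rw [hg]
    nlinarith
  · have : |S.h r| ≤ 1 / (1 - S.η s) * B := by
      rw [hh, abs_mul, abs_div, abs_of_pos hr1, abs_of_pos hr2, he]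
      refine mul_le_mul ?_ (hB r (hS.Icc_subset hrs)) (abs_nonneg _) (by positivity)
      exact div_le_div₀ zero_le_one hr3 hη0 (by linarith [hS.η_le hrs])
    linarith

theorem hasDerivAt_scale (hS : S.IsStart s) {r : ℝ} (hr : r ∈ Ioo 0 s) :
    HasDerivAt S.scale (S.f r * S.scale r) r := by
  obtain ⟨a, e, hα, hη, -, -, -, -, hf, -, -⟩ := hS.exists_deriv hr
  have hr1 := hS.α_pos_of_mem (Ioo_subset_Icc_self hr)
  have hr2 := sub_pos.2 (hS.η_lt_one_of_mem (Ioo_subset_Icc_self hr))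
  refine (hα.mul (hη.const_sub 1)).congr_deriv ?_
  rw [hf, scale]
  field_simp
  ring

theorem hasDerivAt_σ (hS : S.IsStart s) {r : ℝ} (hr : r ∈ Ioo 0 s) :
    HasDerivAt S.σ ((S.g r ^ 2 + 2 * S.f r * S.σ r ^ 2) / (2 * S.σ r)) r := by
  obtain ⟨a, e, hα, -, -, -, -, -, -, -, hg⟩ := hS.exists_deriv hr
  have hrs := Ioo_subset_Icc_self hr
  have hσ := hS.σ_pos r ⟨hr.1, hr.2.le⟩
  have h1 : S.σ =ᶠ[𝓝 r] fun u => √(1 - S.α u ^ 2) := by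
    filter_upwards [Icc_mem_nhds hr.1 hr.2] with u hu
    rw [← hS.σ_sq hu, Real.sqrt_sq (hS.σ_nonneg hu)]
  have h2 := (((hα.pow 2).const_sub 1).sqrt
    (by simp only [Pi.pow_apply]; rw [← hS.σ_sq hrs]; positivity))
  refine (h2.congr_of_eventuallyEq h1).congr_deriv ?_
  simp only [Pi.pow_apply]
  rw [← hS.σ_sq hrs, Real.sqrt_sq hσ.le, hg]
  field_simp
  ring

theorem hasDerivAt_lam (hS : S.IsStart s) {r : ℝ} (hr : r ∈ Ioo 0 s) :
    HasDerivAt S.lam (S.rate r * (S.lam r ^ 3 / 2)) r := by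
  have hσ := hS.σ_pos r ⟨hr.1, hr.2.le⟩
  have ha := hS.scale_pos (Ioo_subset_Icc_self hr)
  refine ((hS.hasDerivAt_σ hr).div (hS.hasDerivAt_scale hr) ha.ne').congr_deriv ?_
  have : S.lam r = S.σ r / S.scale r := rfl
  rw [rate, factor, this]
  field_simp
  ring

theorem hasDerivAt_factor (hS : S.IsStart s) {r : ℝ} (hr : r ∈ Ioo 0 s) :
    HasDerivAt S.factor (S.factorDeriv r) r := by
  have hσ := hS.σ_pos r ⟨hr.1, hr.2.le⟩
  have ha := hS.scale_pos (Ioo_subset_Icc_self hr)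
  refine ((hS.hasDerivAt_scale hr).div ((hS.hasDerivAt_σ hr).pow 2)
    (by simp only [Pi.pow_apply]; positivity)).congr_deriv ?_
  simp only [factorDeriv, factor, Pi.pow_apply]
  field_simp
  ring

/-- The product of `scale` and `factor` is 1/λ²; integrating this derivative yields the variance of
the noise. -/
theorem hasDerivAt_scale_mul_factor (hS : S.IsStart s) {r : ℝ} (hr : r ∈ Ioo 0 s) :
    HasDerivAt (fun u => -(S.scale u * S.factor u)) (S.rate r) r := by
  have hσ := hS.σ_pos r ⟨hr.1, hr.2.le⟩
  refine ((hS.hasDerivAt_scale hr).mul (hS.hasDerivAt_factor hr)).neg.congr_deriv ?_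
  simp only [factorDeriv, factor, rate]
  field_simp
  ring

/-- The coefficient of x̂₀ in the SDE, once multiplied by the integrating factor, is an exact
derivative; this is what the choice of `h` achieves. -/
theorem hasDerivAt_shift (hS : S.IsStart s) {r : ℝ} (hr : r ∈ Ioo 0 s) :
    HasDerivAt (fun u => S.α u * S.η u * S.factor u)
      (S.factor r * (S.h r - S.g r ^ 2 * (S.α r * S.η r) / S.σ r ^ 2)) r := by
  obtain ⟨a, e, hα, hη, -, -, -, -, hf, hh, -⟩ := hS.exists_deriv hr
  have hσ := hS.σ_pos r ⟨hr.1, hr.2.le⟩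
  have hr1 := hS.α_pos_of_mem (Ioo_subset_Icc_self hr)
  have hr2 := sub_pos.2 (hS.η_lt_one_of_mem (Ioo_subset_Icc_self hr))
  refine ((hα.mul hη).mul (hS.hasDerivAt_factor hr)).congr_deriv ?_
  simp only [factorDeriv, factor, scale, hf, hh, Pi.mul_apply]
  field_simp
  ring

theorem rate_nonneg (r : ℝ) : 0 ≤ S.rate r := mul_nonneg (sq_nonneg _) (sq_nonneg _)

theorem σ_pos_of_mem (hS : S.IsStart s) {t : ℝ} (ht : t ∈ Icc 0 s) (hσ : 0 < S.σ t) {r : ℝ}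
    (hr : r ∈ Icc t s) : 0 < S.σ r :=
  hσ.trans_le (hS.σ_monotoneOn ht ⟨ht.1.trans hr.1, hr.2⟩ hr.1)

theorem factor_continuousOn (hS : S.IsStart s) {t : ℝ} (ht : t ∈ Icc 0 s) (hσ : 0 < S.σ t) :
    ContinuousOn S.factor (Icc t s) := by
  have hsub : Icc t s ⊆ Icc 0 s := Icc_subset_Icc_left ht.1
  exact (hS.scale_continuousOn.mono hsub).div ((hS.σ_continuousOn.mono hsub).pow 2) fun r hr =>
    (pow_pos (hS.σ_pos_of_mem ht hσ hr) 2).ne'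

theorem factor_pos (hS : S.IsStart s) {t : ℝ} (ht : t ∈ Icc 0 s) (hσ : 0 < S.σ t) :
    0 < S.factor t := div_pos (hS.scale_pos ht) (pow_pos hσ 2)

theorem aestronglyMeasurable_derivWithin {F : ℝ → ℝ} (hS : S.IsStart s) :
    AEStronglyMeasurable (derivWithin F (Icc 0 T)) (volume.restrict (Ioo 0 s)) := by
  refine (measurable_deriv F).aestronglyMeasurable.congr ?_
  filter_upwards [ae_restrict_mem measurableSet_Ioo] with r hr
  exact (derivWithin_of_mem_nhds (Icc_mem_nhds hr.1 (hr.2.trans_le hS.le_T))).symm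

theorem aestronglyMeasurable_f (hS : S.IsStart s) :
    AEStronglyMeasurable S.f (volume.restrict (Ioo 0 s)) := hS.aestronglyMeasurable_derivWithin

theorem aestronglyMeasurable_h (hS : S.IsStart s) :
    AEStronglyMeasurable S.h (volume.restrict (Ioo 0 s)) := by
  have h1 : ContinuousOn (fun r => S.α r / (1 - S.η r)) (Ioo 0 s) :=
    ((hS.α_continuousOn.div (continuousOn_const.sub hS.η_continuousOn) fun r hr =>
      (sub_pos.2 (hS.η_lt_one_of_mem hr)).ne').mono Ioo_subset_Icc_self)
  exact (h1.aestronglyMeasurable measurableSet_Ioo).mul hS.aestronglyMeasurable_derivWithin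

theorem aestronglyMeasurable_g_sq (hS : S.IsStart s) :
    AEStronglyMeasurable (fun r => S.g r ^ 2) (volume.restrict (Ioo 0 s)) := by
  have h1 : AEStronglyMeasurable (fun r => S.σ r ^ 2) (volume.restrict (Ioo 0 s)) :=
    ((hS.σ_continuousOn.mono Ioo_subset_Icc_self).pow 2).aestronglyMeasurable measurableSet_Ioo
  have h2 := (hS.aestronglyMeasurable_derivWithin (F := fun u => S.σ u ^ 2)).sub
    ((hS.aestronglyMeasurable_f.const_mul 2).mul h1)
  exact (Real.continuous_sqrt.comp_aestronglyMeasurable h2).pow 2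

theorem integrableOn_Icc_of_bound {φ : ℝ → ℝ} {K : ℝ} {t : ℝ} (ht : 0 ≤ t)
    (hm : AEStronglyMeasurable φ (volume.restrict (Ioo 0 s))) (hb : ∀ r ∈ Ioo 0 s, |φ r| ≤ K) :
    IntegrableOn φ (Icc t s) := by
  rw [integrableOn_Icc_iff_integrableOn_Ioo]
  have : IntegrableOn φ (Ioo 0 s) := by
    refine IntegrableOn.of_bound (by simp) hm K ?_
    filter_upwards [ae_restrict_mem measurableSet_Ioo] with r hr
    exact hb r hr
  exact this.mono_set (Ioo_subset_Ioo_left ht)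

theorem integrableOn_f (hS : S.IsStart s) {t : ℝ} (ht : 0 ≤ t) : IntegrableOn S.f (Icc t s) := by
  obtain ⟨K, hK⟩ := hS.exists_bound
  exact integrableOn_Icc_of_bound ht hS.aestronglyMeasurable_f fun r hr => (hK r hr).1

theorem integrableOn_h (hS : S.IsStart s) {t : ℝ} (ht : 0 ≤ t) : IntegrableOn S.h (Icc t s) := by
  obtain ⟨K, hK⟩ := hS.exists_bound
  exact integrableOn_Icc_of_bound ht hS.aestronglyMeasurable_h fun r hr => (hK r hr).2.2

theorem integrableOn_g_sq (hS : S.IsStart s) {t : ℝ} (ht : 0 ≤ t) :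
    IntegrableOn (fun r => S.g r ^ 2) (Icc t s) := by
  obtain ⟨K, hK⟩ := hS.exists_bound
  refine integrableOn_Icc_of_bound (K := K) ht hS.aestronglyMeasurable_g_sq fun r hr => ?_
  rw [abs_of_nonneg (sq_nonneg _)]
  exact (hK r hr).2.1

theorem integrableOn_g_sq_div (hS : S.IsStart s) {t : ℝ} (ht : t ∈ Icc 0 s) (hσ : 0 < S.σ t) :
    IntegrableOn (fun r => S.g r ^ 2 / S.σ r ^ 2) (Icc t s) := by
  have hc : ContinuousOn (fun r => (S.σ r ^ 2)⁻¹) (Icc t s) :=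
    ((hS.σ_continuousOn.mono (Icc_subset_Icc_left ht.1)).pow 2).inv₀ fun r hr =>
      (pow_pos (hS.σ_pos_of_mem ht hσ hr) 2).ne'
  exact (hS.integrableOn_g_sq ht.1).mul_continuousOn hc isCompact_Icc

theorem integrableOn_factorDeriv (hS : S.IsStart s) {t : ℝ} (ht : t ∈ Icc 0 s) (hσ : 0 < S.σ t) :
    IntegrableOn S.factorDeriv (Icc t s) :=
  (((hS.integrableOn_f ht.1).add (hS.integrableOn_g_sq_div ht hσ)).mul_continuousOn
    (hS.factor_continuousOn ht hσ) isCompact_Icc).neg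

theorem integrableOn_rate (hS : S.IsStart s) {t : ℝ} (ht : t ∈ Icc 0 s) (hσ : 0 < S.σ t) :
    IntegrableOn S.rate (Icc t s) :=
  (hS.integrableOn_g_sq ht.1).continuousOn_mul ((hS.factor_continuousOn ht hσ).pow 2) isCompact_Icc

theorem integrableOn_shiftDeriv (hS : S.IsStart s) {t : ℝ} (ht : t ∈ Icc 0 s) (hσ : 0 < S.σ t) :
    IntegrableOn (fun r => S.factor r * (S.h r - S.g r ^ 2 * (S.α r * S.η r) / S.σ r ^ 2))
      (Icc t s) := by
  have hsub : Icc t s ⊆ Icc 0 s := Icc_subset_Icc_left ht.1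
  have h1 := (hS.integrableOn_g_sq_div ht hσ).mul_continuousOn
    ((hS.α_continuousOn.mul hS.η_continuousOn).mono hsub) isCompact_Icc
  have h2 := ((hS.integrableOn_h ht.1).sub h1).continuousOn_mul
    (hS.factor_continuousOn ht hσ) isCompact_Icc
  refine h2.congr_fun (fun r _ => ?_) measurableSet_Icc
  simp only [Pi.sub_apply, Pi.mul_apply]
  ring

theorem setIntegral_eq_sub {F F' : ℝ → ℝ} {t r : ℝ} (ht : t ∈ Icc 0 s)
    (hr : r ∈ Icc t s) (hc : ContinuousOn F (Icc t s)) (hd : ∀ r ∈ Ioo 0 s, HasDerivAt F (F' r) r)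
    (hi : IntegrableOn F' (Icc t s)) : ∫ u in Ioc t r, F' u = F r - F t := by
  rw [← intervalIntegral.integral_of_le hr.1]
  refine intervalIntegral.integral_eq_sub_of_hasDerivAt_of_le hr.1
    (hc.mono (Icc_subset_Icc_right hr.2))
    (fun u hu => hd u ⟨ht.1.trans_lt hu.1, hu.2.trans_le hr.2⟩) ?_
  rw [intervalIntegrable_iff_integrableOn_Icc_of_le hr.1]
  exact hi.mono_set (Icc_subset_Icc_right hr.2)

theorem setIntegral_factorDeriv (hS : S.IsStart s) {t r : ℝ} (ht : t ∈ Icc 0 s) (hσ : 0 < S.σ t)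
    (hr : r ∈ Icc t s) : ∫ u in Ioc t r, S.factorDeriv u = S.factor r - S.factor t :=
  IsStart.setIntegral_eq_sub ht hr (hS.factor_continuousOn ht hσ)
    (fun _ h => hS.hasDerivAt_factor h)
    (hS.integrableOn_factorDeriv ht hσ)

theorem setIntegral_rate (hS : S.IsStart s) {t : ℝ} (ht : t ∈ Icc 0 s) (hσ : 0 < S.σ t) :
    ∫ u in Ioc t s, S.rate u = 1 / S.lam t ^ 2 - 1 / S.lam s ^ 2 := by
  have hsub : Icc t s ⊆ Icc 0 s := Icc_subset_Icc_left ht.1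
  have h1 : ∀ u, 0 < S.σ u → u ∈ Icc 0 s → S.scale u * S.factor u = 1 / S.lam u ^ 2 := by
    intro u hu hus
    have h2 := hS.scale_pos hus
    have : S.lam u = S.σ u / S.scale u := rfl
    rw [this, factor]
    field_simp
  rw [IsStart.setIntegral_eq_sub (F := fun u => -(S.scale u * S.factor u)) ht ⟨ht.2, le_rfl⟩
    ((hS.scale_continuousOn.mono hsub).mul (hS.factor_continuousOn ht hσ)).neg
    (fun _ h => hS.hasDerivAt_scale_mul_factor h) (hS.integrableOn_rate ht hσ),
    h1 t hσ ht, h1 s (hS.σ_pos s ⟨hS.pos, le_rfl⟩) hS.s_mem]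
  ring

theorem setIntegral_shiftDeriv (hS : S.IsStart s) {t : ℝ} (ht : t ∈ Icc 0 s) (hσ : 0 < S.σ t) :
    ∫ r in Ioc t s, S.factor r * (S.h r - S.g r ^ 2 * (S.α r * S.η r) / S.σ r ^ 2)
      = S.α s * S.η s * S.factor s - S.α t * S.η t * S.factor t := by
  have hsub : Icc t s ⊆ Icc 0 s := Icc_subset_Icc_left ht.1
  exact IsStart.setIntegral_eq_sub (F := fun u => S.α u * S.η u * S.factor u) ht ⟨ht.2, le_rfl⟩
    (((hS.α_continuousOn.mul hS.η_continuousOn).mono hsub).mul (hS.factor_continuousOn ht hσ))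
    (fun _ h => hS.hasDerivAt_shift h) (hS.integrableOn_shiftDeriv ht hσ)

/-- A second time with the same λ would make the monotone function λ constant in between, so its
derivative at `r` would vanish, although it is a nonzero multiple of `rate`. -/
theorem timeOf_lam (hS : S.IsStart s) {r : ℝ} (hr : r ∈ Ioo 0 s) (hrate : S.rate r ≠ 0) :
    S.timeOf s (S.lam r) = r := by
  have hrs := Ioo_subset_Icc_self hr
  have hex : ∃ u ∈ Icc 0 s, S.lam u = S.lam r := ⟨r, hrs, rfl⟩
  have hmem : S.timeOf s (S.lam r) ∈ Icc 0 s := Function.invFunOn_mem hex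
  have heq : S.lam (S.timeOf s (S.lam r)) = S.lam r := Function.invFunOn_eq hex
  set u := S.timeOf s (S.lam r) with hu
  have hd := hS.hasDerivAt_lam hr
  have hσ := hS.σ_pos r ⟨hr.1, hr.2.le⟩
  have hne : S.rate r * (S.lam r ^ 3 / 2) ≠ 0 :=
    mul_ne_zero hrate (by have := hS.lam_pos hrs hσ; positivity)
  by_contra hur
  refine hne ?_
  rcases lt_or_gt_of_ne hur with h | h
  · have h1 : HasDerivWithinAt S.lam 0 (Icc u r) r := by
      refine (hasDerivWithinAt_const r _ (S.lam r)).congr (fun v hv => ?_) rfl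
      have hv' : v ∈ Icc 0 s := ⟨hmem.1.trans hv.1, hv.2.trans hrs.2⟩
      exact le_antisymm (hS.lam_monotoneOn hv' hrs hv.2)
        (heq ▸ hS.lam_monotoneOn hmem hv' hv.1)
    exact (uniqueDiffOn_Icc h r ⟨h.le, le_rfl⟩).eq_deriv _ hd.hasDerivWithinAt h1
  · have h1 : HasDerivWithinAt S.lam 0 (Icc r u) r := by
      refine (hasDerivWithinAt_const r _ (S.lam r)).congr (fun v hv => ?_) rfl
      have hv' : v ∈ Icc 0 s := ⟨hrs.1.trans hv.1, hv.2.trans hmem.2⟩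
      exact le_antisymm (heq ▸ hS.lam_monotoneOn hv' hmem hv.2)
        (hS.lam_monotoneOn hrs hv' hv.1)
    exact (uniqueDiffOn_Icc h r ⟨le_rfl, h.le⟩).eq_deriv _ hd.hasDerivWithinAt h1

end IsStart

end Schedule

/-! ### Variation of constants and the change of variable to λ along one path. -/

section Pathwise

/-- Fubini on the triangle t < r < u ≤ s. -/
theorem setIntegral_smul_primitive {F : Type*} [NormedAddCommGroup F] [NormedSpace ℝ F]
    [CompleteSpace F] {t s : ℝ} {q : ℝ → ℝ} {b : ℝ → F} (hq : IntegrableOn q (Ioc t s))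
    (hb : IntegrableOn b (Ioc t s)) :
    ∫ r in Ioc t s, q r • ∫ u in Ioc r s, b u = ∫ u in Ioc t s, (∫ r in Ioc t u, q r) • b u := by
  have hint : Integrable (Function.uncurry fun r u => {p : ℝ × ℝ | p.1 < p.2}.indicator
      (fun p => q p.1 • b p.2) (r, u))
      ((volume.restrict (Ioc t s)).prod (volume.restrict (Ioc t s))) :=
    (Integrable.smul_prod hq hb).indicator (measurableSet_lt measurable_fst measurable_snd)
  have h1 : ∀ r ∈ Ioc t s, q r • ∫ u in Ioc r s, b u = ∫ u in Ioc t s,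
      {p : ℝ × ℝ | p.1 < p.2}.indicator (fun p => q p.1 • b p.2) (r, u) := by
    intro r hr
    have : ∀ u, {p : ℝ × ℝ | p.1 < p.2}.indicator (fun p => q p.1 • b p.2) (r, u)
        = q r • (Ioi r).indicator b u := by
      intro u
      by_cases h : r < u <;> simp [indicator, h]
    simp only [this]
    rw [integral_smul, setIntegral_indicator measurableSet_Ioi]
    congr 3
    ext u
    simp only [mem_Ioc, mem_inter_iff, mem_Ioi]
    exact ⟨fun h => ⟨⟨hr.1.trans h.1, h.2⟩, h.1⟩, fun h => ⟨h.2, h.1.2⟩⟩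
  have h2 : ∀ u ∈ Ioc t s, (∫ r in Ioc t u, q r) • b u = ∫ r in Ioc t s,
      {p : ℝ × ℝ | p.1 < p.2}.indicator (fun p => q p.1 • b p.2) (r, u) := by
    intro u hu
    have : ∀ r, {p : ℝ × ℝ | p.1 < p.2}.indicator (fun p => q p.1 • b p.2) (r, u)
        = (Iio u).indicator q r • b u := by
      intro r
      by_cases h : r < u <;> simp [indicator, h]
    simp only [this]
    rw [integral_smul_const, setIntegral_indicator measurableSet_Iio, integral_Ioc_eq_integral_Ioo]
    congr 3
    ext r
    simp only [mem_Ioc, mem_inter_iff, mem_Iio, mem_Ioo]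
    exact ⟨fun h => ⟨⟨h.1, h.2.le.trans hu.2⟩, h.2⟩, fun h => ⟨h.1.1, h.2⟩⟩
  rw [setIntegral_congr_fun measurableSet_Ioc h1, setIntegral_congr_fun measurableSet_Ioc h2]
  exact integral_integral_swap hint

variable {d : ℕ} {T : ℝ} {S : Schedule T} {s : ℝ}
  {xθ : EuclideanSpace ℝ (Fin d) → EuclideanSpace ℝ (Fin d) → ℝ → EuclideanSpace ℝ (Fin d)}
  {xhat : EuclideanSpace ℝ (Fin d)}

namespace Schedule.IsStart

theorem factor_smul_drift (r : ℝ) (x : EuclideanSpace ℝ (Fin d)) :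
    S.factorDeriv r • x + S.factor r • S.drift xθ xhat r x
      = (S.factor r * (S.h r - S.g r ^ 2 * (S.α r * S.η r) / S.σ r ^ 2)) • xhat
        - S.rate r • xθ x xhat r := by
  simp only [factorDeriv, drift, score, rate, factor, scale]
  module

variable {x : ℝ → EuclideanSpace ℝ (Fin d)}

/-- The model `xθ` carries no regularity assumption. Integrability comes from that of the drift, all
other terms of `factor_smul_drift` being integrable. -/
theorem integrableOn_rate_smul (hS : S.IsStart s) {t : ℝ} (ht : t ∈ Icc 0 s) (hσ : 0 < S.σ t)
    (hx : ContinuousOn x (Icc 0 s))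
    (hd : IntegrableOn (fun r => S.drift xθ xhat r (x r)) (Icc t s)) :
    IntegrableOn (fun r => S.rate r • xθ (x r) xhat r) (Icc t s) := by
  have hsub : Icc t s ⊆ Icc 0 s := Icc_subset_Icc_left ht.1
  have h1 := (hS.integrableOn_factorDeriv ht hσ).smul_continuousOn (hx.mono hsub) isCompact_Icc
  have h2 := hd.continuousOn_smul (hS.factor_continuousOn ht hσ) isCompact_Icc
  have h3 := (hS.integrableOn_shiftDeriv ht hσ).smul_const xhat
  refine IntegrableOn.congr_fun (h3.sub (h1.add h2)) (fun r _ => ?_) measurableSet_Icc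
  simp only [Pi.sub_apply, Pi.add_apply, factor_smul_drift]
  abel

/-- The scalar on the left is λ'. Where `rate` vanishes, `timeOf` may select another time, but then
both sides are zero; hence strict monotonicity of λ is not needed. -/
theorem lam_rate_smul (hS : S.IsStart s) {t r : ℝ} (hr : r ∈ Ioo 0 s) :
    (S.rate r * (S.lam r ^ 3 / 2)) • integrand S xθ xhat s x t (S.lam r)
      = S.lam t ^ 2 • S.rate r • xθ (x r) xhat r := by
  by_cases h0 : S.rate r = 0
  · simp [h0]
  · have hl := hS.lam_pos (Ioo_subset_Icc_self hr) (hS.σ_pos r ⟨hr.1, hr.2.le⟩)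
    rw [integrand, hS.timeOf_lam hr h0, smul_smul, smul_smul]
    congr 1
    field_simp

theorem lam_le (hS : S.IsStart s) {t : ℝ} (ht : t ∈ Icc 0 s) : S.lam t ≤ S.lam s :=
  hS.lam_monotoneOn ht hS.s_mem ht.2

theorem lamDeriv_nonneg (hS : S.IsStart s) {t : ℝ} (ht : t ∈ Icc 0 s) :
    ∀ r ∈ Ioo t s, 0 ≤ S.rate r * (S.lam r ^ 3 / 2) := fun r hr => by
  have hr' : r ∈ Icc 0 s := ⟨ht.1.trans hr.1.le, hr.2.le⟩
  have := hS.lam_pos hr' (hS.σ_pos r ⟨ht.1.trans_lt hr.1, hr.2.le⟩)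
  exact mul_nonneg (rate_nonneg r) (by positivity)

/-- Substitution along a nondecreasing λ is an equivalence for integrability, so absolute
convergence in λ is read off in the time variable. -/
theorem intervalIntegrable_integrand (hS : S.IsStart s) {t : ℝ} (ht : t ∈ Icc 0 s)
    (hσ : 0 < S.σ t) (hx : ContinuousOn x (Icc 0 s))
    (hd : IntegrableOn (fun r => S.drift xθ xhat r (x r)) (Icc t s)) :
    IntervalIntegrable (integrand S xθ xhat s x t) volume (S.lam s) (S.lam t) := by
  refine IntervalIntegrable.symm ?_
  rw [intervalIntegrable_iff_integrableOn_Icc_of_le (hS.lam_le ht),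
    ← integrableOn_Icc_deriv_smul_iff_of_deriv_nonneg
      (hS.lam_continuousOn.mono (Icc_subset_Icc_left ht.1))
      (fun r hr => hS.hasDerivAt_lam ⟨ht.1.trans_lt hr.1, hr.2⟩) (hS.lamDeriv_nonneg ht) ht.2,
    integrableOn_Icc_iff_integrableOn_Ioo]
  have h1 : IntegrableOn (fun r => S.lam t ^ 2 • S.rate r • xθ (x r) xhat r) (Ioo t s) :=
    ((hS.integrableOn_rate_smul ht hσ hx hd).mono_set Ioo_subset_Icc_self).smul (S.lam t ^ 2)
  exact h1.congr_fun (fun r hr => (hS.lam_rate_smul ⟨ht.1.trans_lt hr.1, hr.2⟩).symm)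
    measurableSet_Ioo

theorem integral_integrand (hS : S.IsStart s) {t : ℝ} (ht : t ∈ Icc 0 s) :
    ∫ l in (S.lam s)..(S.lam t), integrand S xθ xhat s x t l
      = -(S.lam t ^ 2 • ∫ r in Ioc t s, S.rate r • xθ (x r) xhat r) := by
  rw [intervalIntegral.integral_symm, intervalIntegral.integral_of_le (hS.lam_le ht),
    ← integral_Icc_eq_integral_Ioc, ← integral_Icc_deriv_smul_of_deriv_nonneg
      (hS.lam_continuousOn.mono (Icc_subset_Icc_left ht.1))
      (fun r hr => hS.hasDerivAt_lam ⟨ht.1.trans_lt hr.1, hr.2⟩) (hS.lamDeriv_nonneg ht) ht.2,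
    integral_Icc_eq_integral_Ioo, integral_Ioc_eq_integral_Ioo, ← integral_smul]
  congr 1
  exact setIntegral_congr_fun measurableSet_Ioo fun r hr =>
    hS.lam_rate_smul ⟨ht.1.trans_lt hr.1, hr.2⟩

/-- Variation of constants along one path. -/
theorem sub_closedForm_zero (hS : S.IsStart s) {t : ℝ} (ht : t ∈ Icc 0 s) (hσ : 0 < S.σ t)
    (hx : ContinuousOn x (Icc 0 s))
    (hd : IntegrableOn (fun r => S.drift xθ xhat r (x r)) (Icc t s)) :
    x t - closedForm S xθ xhat s x t 0
      = (S.factor t)⁻¹ • (S.factor t • (x t - x s - ∫ v in s..t, S.drift xθ xhat v (x v))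
        + ∫ r in Ioc t s, S.factorDeriv r •
            (x r - x s - ∫ v in s..r, S.drift xθ xhat v (x v))) := by
  set b : ℝ → EuclideanSpace ℝ (Fin d) := fun r => S.drift xθ xhat r (x r) with hb
  have hsub : Icc t s ⊆ Icc 0 s := Icc_subset_Icc_left ht.1
  have hoc : Ioc t s ⊆ Icc t s := Ioc_subset_Icc_self
  have hJ : ∀ r ∈ Icc t s, x r - x s - ∫ v in s..r, b v = x r - x s + ∫ v in Ioc r s, b v := by
    intro r hr
    rw [intervalIntegral.integral_symm, intervalIntegral.integral_of_le hr.2, sub_neg_eq_add]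
  have hm := hS.integrableOn_factorDeriv ht hσ
  have hmx := hm.smul_continuousOn (hx.mono hsub) isCompact_Icc
  have hmb := hd.continuousOn_smul (hS.factor_continuousOn ht hσ) isCompact_Icc
  have hdc : IntegrableOn (fun r => S.factor t • b r) (Icc t s) := hd.smul (S.factor t)
  -- After Fubini the weight of the drift at time r is ∫_t^r m' = m_r - m_t.
  have hprim : ∫ r in Ioc t s, S.factorDeriv r • ∫ v in Ioc r s, b v
      = (∫ r in Ioc t s, S.factor r • b r) - S.factor t • ∫ r in Ioc t s, b r := by
    rw [setIntegral_smul_primitive (hm.mono_set hoc) (hd.mono_set hoc), ← integral_smul,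
      ← integral_sub (hmb.mono_set hoc) (hdc.mono_set hoc)]
    refine setIntegral_congr_fun measurableSet_Ioc fun r hr => ?_
    rw [hS.setIntegral_factorDeriv ht hσ (hoc hr), sub_smul]
  have hprimint : IntegrableOn (fun r => S.factorDeriv r • ∫ v in Ioc r s, b v) (Icc t s) := by
    refine hm.smul_continuousOn ?_ isCompact_Icc
    have h1 : IntervalIntegrable b volume t s :=
      (intervalIntegrable_iff_integrableOn_Icc_of_le ht.2).2 hd
    have h2 := (intervalIntegral.continuousOn_primitive_interval' (a := s) h1 right_mem_uIcc).neg
    rw [uIcc_of_le ht.2] at h2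
    refine h2.congr fun r hr => ?_
    simp only [Pi.neg_apply]
    rw [intervalIntegral.integral_symm, intervalIntegral.integral_of_le hr.2, neg_neg]
  have hsplit : ∫ r in Ioc t s, S.factorDeriv r • (x r - x s - ∫ v in s..r, b v)
      = (∫ r in Ioc t s, (S.factorDeriv r • x r + S.factor r • b r))
        - (S.factor s - S.factor t) • x s - S.factor t • ∫ r in Ioc t s, b r := by
    have h1 : ∫ r in Ioc t s, S.factorDeriv r • (x r - x s - ∫ v in s..r, b v)
        = ∫ r in Ioc t s, (S.factorDeriv r • x r - S.factorDeriv r • x s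
          + S.factorDeriv r • ∫ v in Ioc r s, b v) := by
      refine setIntegral_congr_fun measurableSet_Ioc fun r hr => ?_
      rw [hJ r (hoc hr), smul_add, smul_sub]
    have hmc : IntegrableOn (fun r => S.factorDeriv r • x s) (Ioc t s) :=
      (hm.mono_set hoc).smul_const (x s)
    have hmd : IntegrableOn (fun r => S.factorDeriv r • x r - S.factorDeriv r • x s) (Ioc t s) :=
      (hmx.mono_set hoc).sub hmc
    rw [h1, integral_add hmd (hprimint.mono_set hoc),
      integral_sub (hmx.mono_set hoc) hmc, hprim, integral_smul_const,
      hS.setIntegral_factorDeriv ht hσ ⟨ht.2, le_rfl⟩,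
      integral_add (hmx.mono_set hoc) (hmb.mono_set hoc)]
    abel
  -- The integrand is m'x + m·drift, in which the terms linear in x cancel.
  have hforce : ∫ r in Ioc t s, (S.factorDeriv r • x r + S.factor r • b r)
      = (S.α s * S.η s * S.factor s - S.α t * S.η t * S.factor t) • xhat
        - ∫ r in Ioc t s, S.rate r • xθ (x r) xhat r := by
    simp only [hb, factor_smul_drift]
    rw [integral_sub (((hS.integrableOn_shiftDeriv ht hσ).mono_set hoc).smul_const xhat)
      ((hS.integrableOn_rate_smul ht hσ hx hd).mono_set hoc), integral_smul_const,
      hS.setIntegral_shiftDeriv ht hσ]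
  rw [hsplit, hforce, hJ t ⟨le_rfl, ht.2⟩, closedForm, hS.integral_integrand ht]
  have hs := hS.s_mem
  have ht1 := hS.α_pos_of_mem ht
  have ht2 := sub_pos.2 (hS.η_lt_one_of_mem ht)
  have hs1 := hS.α_pos_of_mem hs
  have hs2 := sub_pos.2 (hS.η_lt_one_of_mem hs)
  have hσs := hS.σ_pos s ⟨hS.pos, le_rfl⟩
  have hmt := hS.factor_pos ht hσ
  have e1 : (S.α t * (1 - S.η t)) / (S.α s * (1 - S.η s)) * (S.lam t ^ 2 / S.lam s ^ 2)
      = (S.factor t)⁻¹ * S.factor s := by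
    simp only [factor, scale, lam]
    field_simp
  have e2 : S.α t * (1 - S.η t) *
      (S.η t / (1 - S.η t) - S.η s / (1 - S.η s) * (S.lam t ^ 2 / S.lam s ^ 2))
      = -((S.factor t)⁻¹ * (S.α s * S.η s * S.factor s - S.α t * S.η t * S.factor t)) := by
    simp only [factor, scale, lam]
    field_simp
    ring
  have e3 : S.α t * (1 - S.η t) * S.lam t ^ 2 = (S.factor t)⁻¹ := by
    simp only [factor, scale, lam]
    field_simp
  rw [e1, e2, smul_neg (S.α t * (1 - S.η t)), smul_smul (S.α t * (1 - S.η t)), e3]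
  have e4 : x t = (S.factor t)⁻¹ • S.factor t • x t := by
    rw [smul_smul, inv_mul_cancel₀ hmt.ne', one_smul]
  rw [show S.factor t • (x t - x s + ∫ v in Ioc t s, b v) = S.factor t • x t - S.factor t • x s
    + S.factor t • ∫ v in Ioc t s, b v by rw [smul_add, smul_sub]]
  nth_rewrite 1 [e4]
  module

/-- The right-hand side is the variance of m_t⁻¹ ∫ m g dw̄, so the coefficient in the closed form is
its standard deviation. -/
theorem noiseCoeff_sq (hS : S.IsStart s) {t : ℝ} (ht : t ∈ Icc 0 s) (hσ : 0 < S.σ t) :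
    S.noiseCoeff s t ^ 2 = (S.factor t)⁻¹ ^ 2 * (1 / S.lam t ^ 2 - 1 / S.lam s ^ 2) := by
  have hlt := hS.lam_pos ht hσ
  have hle := hS.lam_le ht
  have hls := hlt.trans_le hle
  have h1 : S.lam t ^ 2 - S.lam t ^ 4 / S.lam s ^ 2
      = S.lam t ^ 4 * (1 / S.lam t ^ 2 - 1 / S.lam s ^ 2) := by
    field_simp
  have h2 : 0 ≤ 1 / S.lam t ^ 2 - 1 / S.lam s ^ 2 :=
    sub_nonneg.2 (one_div_le_one_div_of_le (by positivity) (pow_le_pow_left₀ hlt.le hle 2))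
  have h3 : (S.factor t)⁻¹ = S.α t * (1 - S.η t) * S.lam t ^ 2 := by
    have ht1 := hS.α_pos_of_mem ht
    have ht2 := sub_pos.2 (hS.η_lt_one_of_mem ht)
    simp only [factor, scale, lam]
    field_simp
  rw [noiseCoeff, mul_pow, h1, Real.sq_sqrt (by positivity), h3]
  ring

theorem noiseCoeff_ne_zero (hS : S.IsStart s) {t : ℝ} (ht : t ∈ Icc 0 s) (hσ : 0 < S.σ t)
    (hne : S.lam t ≠ S.lam s) : S.noiseCoeff s t ≠ 0 := by
  have hlt := hS.lam_pos ht hσ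
  have hlts := lt_of_le_of_ne (hS.lam_le ht) hne
  have h : 0 < S.noiseCoeff s t ^ 2 := by
    rw [hS.noiseCoeff_sq ht hσ]
    have := hS.factor_pos ht hσ
    refine mul_pos (by positivity) (sub_pos.2 ?_)
    exact one_div_lt_one_div_of_lt (by positivity) (pow_lt_pow_left₀ hlts hlt.le two_ne_zero)
  exact fun h0 => by simp [h0] at h

theorem noiseCoeff_eq_zero (hS : S.IsStart s) {t : ℝ} (ht : t ∈ Icc 0 s) (hσ : 0 < S.σ t)
    (heq : S.lam t = S.lam s) : S.noiseCoeff s t = 0 := by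
  have h := hS.noiseCoeff_sq ht hσ
  rw [heq, sub_self, mul_zero] at h
  exact pow_eq_zero_iff two_ne_zero |>.1 h

end Schedule.IsStart

theorem closedForm_eq_add (t : ℝ) (x : ℝ → EuclideanSpace ℝ (Fin d))
    (z : EuclideanSpace ℝ (Fin d)) :
    closedForm S xθ xhat s x t z = closedForm S xθ xhat s x t 0 + S.noiseCoeff s t • z := by
  simp [closedForm, Schedule.noiseCoeff]

end Pathwise

/-! ### Law of the noise vector and null sets uniform in time. -/

section Noise

variable {Ω : Type*} {mΩ : MeasurableSpace Ω} {d : ℕ} {P : Measure Ω}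
  {w X : ℝ → Ω → EuclideanSpace ℝ (Fin d)} {s : ℝ} {𝓕 : Filtration ℝᵒᵈ mΩ} {T : ℝ}
  {S : Schedule T}
  {xθ : EuclideanSpace ℝ (Fin d) → EuclideanSpace ℝ (Fin d) → ℝ → EuclideanSpace ℝ (Fin d)}
  {xhat : EuclideanSpace ℝ (Fin d)}

theorem IsBackwardWiener.normalized_incr [IsProbabilityMeasure P]
    (hw : IsBackwardWiener P 𝓕 w s) (hs : 0 < s) :
    AEMeasurable (fun ω => (√s)⁻¹ • (w 0 ω - w s ω)) P ∧
    IsIndepGaussian P (𝓕 (toDual s)) (fun ω => (√s)⁻¹ • (w 0 ω - w s ω)) 1 := by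
  have hc : Finsupp.single (0 : ℝ) (√s)⁻¹ ∈ Finsupp.supported ℝ ℝ (Icc 0 s) :=
    Finsupp.single_mem_supported ℝ _ ⟨le_rfl, hs.le⟩
  have h1 := (aestronglyMeasurable_wienerSum hw hs.le hc).aemeasurable
  have h2 := isIndepGaussian_wienerSum hw hs.le hc
  rw [wienerSum_single] at h1 h2
  refine ⟨h1, ?_⟩
  convert h2 using 1
  rw [stepSum_single, setIntegral_congr_fun (g := fun _ => s⁻¹) measurableSet_Ioc]
  · simp [hs.le, hs.ne']
  · intro r hr
    simp only [indicator_of_mem hr, Pi.one_apply, mul_one, inv_pow, Real.sq_sqrt hs.le]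

/-- Integration by parts is applied with `x` = m_t and `q` = m', so the weight `x` + ∫_t^r `q` of
the noise at time r is m_r and the variance is the integral of `rate`. -/
theorem isIndepGaussian_sub_closedForm [IsProbabilityMeasure P]
    (hS : S.IsStart s) (hw : IsBackwardWiener P 𝓕 w s)
    (hX : IsReverseSolution S xθ xhat P 𝓕 w s X) {t : ℝ} (ht : t ∈ Icc 0 s) (hσ : 0 < S.σ t) :
    AEMeasurable (fun ω => X t ω - closedForm S xθ xhat s (fun r => X r ω) t 0) P ∧
    IsIndepGaussian P (𝓕 (toDual s))
      (fun ω => X t ω - closedForm S xθ xhat s (fun r => X r ω) t 0) (S.noiseCoeff s t ^ 2) := by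
  set J : ℝ → Ω → EuclideanSpace ℝ (Fin d) := fun r ω =>
    X r ω - X s ω - ∫ v in s..r, S.drift xθ xhat v (X v ω) with hJ
  have hsub : Icc t s ⊆ Icc 0 s := Icc_subset_Icc_left ht.1
  have hoc : Ioc t s ⊆ Icc t s := Ioc_subset_Icc_self
  have hW : ∀ r ∈ Icc t s, IsWienerIntegral P w s ((Ioc r s).indicator S.g) (J r) := fun r hr =>
    (hX.equation r (hsub hr) (hS.σ_pos_of_mem ht hσ hr)).isWienerIntegral (hsub hr).1
  have hcont : ∀ᵐ ω ∂P, ContinuousOn (fun r => J r ω) (Icc t s) := by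
    filter_upwards [hX.cont, hX.drift_integrable t ht hσ] with ω h1 h2
    have h3 := intervalIntegral.continuousOn_primitive_interval' (a := s) h2 left_mem_uIcc
    rw [uIcc_of_ge ht.2] at h3
    exact ((h1.mono hsub).sub continuousOn_const).sub h3
  obtain ⟨hm, hG⟩ := isIndepGaussian_integral_by_parts hw ht.1 ht.2 (x := S.factor t) hW hcont
    ((hS.integrableOn_g_sq ht.1).mono_set hoc) ((hS.integrableOn_factorDeriv ht hσ).mono_set hoc)
  have hv : ∫ r in Ioc t s, (S.g r * (S.factor t + ∫ u in Ioc t r, S.factorDeriv u)) ^ 2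
      = 1 / S.lam t ^ 2 - 1 / S.lam s ^ 2 := by
    rw [← hS.setIntegral_rate ht hσ]
    refine setIntegral_congr_fun measurableSet_Ioc fun r hr => ?_
    simp only [hS.setIntegral_factorDeriv ht hσ (hoc hr), add_sub_cancel, Schedule.rate]
    ring
  have heq : (fun ω => (S.factor t)⁻¹ • (S.factor t • J t ω
      + ∫ u in Ioc t s, S.factorDeriv u • J u ω))
      =ᵐ[P] fun ω => X t ω - closedForm S xθ xhat s (fun r => X r ω) t 0 := by
    filter_upwards [hX.cont, hX.drift_integrable t ht hσ] with ω h1 h2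
    have h3 := (intervalIntegrable_iff_integrableOn_Icc_of_le ht.2).1 h2.symm
    exact (hS.sub_closedForm_zero ht hσ h1 h3).symm
  refine ⟨(hm.aemeasurable.const_smul (S.factor t)⁻¹).congr heq, ?_⟩
  have hG' := (hG.const_smul (S.factor t)⁻¹).congr_ae heq
  rwa [hv, ← hS.noiseCoeff_sq ht hσ] at hG'

open Classical in
/-- The noise vector of the closed form; where its coefficient vanishes, the normalized increment
of the Wiener process serves as a standard Gaussian vector. -/
def noise (S : Schedule T)
    (xθ : EuclideanSpace ℝ (Fin d) → EuclideanSpace ℝ (Fin d) → ℝ → EuclideanSpace ℝ (Fin d))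
    (xhat : EuclideanSpace ℝ (Fin d)) (s : ℝ) (w X : ℝ → Ω → EuclideanSpace ℝ (Fin d))
    (t : ℝ) (ω : Ω) : EuclideanSpace ℝ (Fin d) :=
  if 0 < S.σ t ∧ S.lam t ≠ S.lam s then
    (S.noiseCoeff s t)⁻¹ • (X t ω - closedForm S xθ xhat s (fun r => X r ω) t 0)
  else (√s)⁻¹ • (w 0 ω - w s ω)

theorem isIndepGaussian_noise [IsProbabilityMeasure P]
    (hS : S.IsStart s) (hw : IsBackwardWiener P 𝓕 w s)
    (hX : IsReverseSolution S xθ xhat P 𝓕 w s X) {t : ℝ} (ht : t ∈ Icc 0 s) :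
    AEMeasurable (noise S xθ xhat s w X t) P ∧
    IsIndepGaussian P (𝓕 (toDual s)) (noise S xθ xhat s w X t) 1 := by
  by_cases h : 0 < S.σ t ∧ S.lam t ≠ S.lam s
  · obtain ⟨h1, h2⟩ := isIndepGaussian_sub_closedForm hS hw hX ht h.1
    have hne := hS.noiseCoeff_ne_zero ht h.1 h.2
    have heq : noise S xθ xhat s w X t = fun ω => (S.noiseCoeff s t)⁻¹ •
        (X t ω - closedForm S xθ xhat s (fun r => X r ω) t 0) := by
      ext1 ω
      rw [noise, if_pos h]
    rw [heq]
    refine ⟨h1.const_smul (S.noiseCoeff s t)⁻¹, ?_⟩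
    have h3 := h2.const_smul (S.noiseCoeff s t)⁻¹
    rwa [inv_pow, inv_mul_cancel₀ (pow_ne_zero 2 hne)] at h3
  · have heq : noise S xθ xhat s w X t = fun ω => (√s)⁻¹ • (w 0 ω - w s ω) := by
      ext1 ω
      rw [noise, if_neg h]
    rw [heq]
    exact hw.normalized_incr hS.pos

theorem ae_integrableOn_drift (hS : S.IsStart s) (hX : IsReverseSolution S xθ xhat P 𝓕 w s X) :
    ∀ᵐ ω ∂P, ∀ t ∈ Icc 0 s, 0 < S.σ t →
      IntegrableOn (fun r => S.drift xθ xhat r (X r ω)) (Icc t s) := by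
  have hIcc : ∀ t ∈ Icc 0 s, 0 < S.σ t →
      ∀ᵐ ω ∂P, IntegrableOn (fun r => S.drift xθ xhat r (X r ω)) (Icc t s) := by
    intro t ht hσ
    filter_upwards [hX.drift_integrable t ht hσ] with ω h
    exact (intervalIntegrable_iff_integrableOn_Icc_of_le ht.2).1 h.symm
  -- Integrability on an interval passes to smaller ones, so one null set for the times s/(n+1), and
  -- one for 0 if σ₀ > 0, serves every t.
  have hu : ∀ n : ℕ, s / (n + 1) ∈ Ioc 0 s := fun n =>
    ⟨div_pos hS.pos (by positivity), div_le_self hS.pos.le (by simp)⟩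
  have h0 : ∀ᵐ ω ∂P, 0 < S.σ 0 →
      IntegrableOn (fun r => S.drift xθ xhat r (X r ω)) (Icc 0 s) := by
    by_cases h : 0 < S.σ 0
    · filter_upwards [hIcc 0 ⟨le_rfl, hS.pos.le⟩ h] with ω hω _ using hω
    · exact Eventually.of_forall fun ω h' => absurd h' h
  filter_upwards [h0, ae_all_iff.2 fun n : ℕ =>
    hIcc _ (Ioc_subset_Icc_self (hu n)) (hS.σ_pos _ (hu n))] with ω hω0 hω t ht hσ
  rcases eq_or_lt_of_le ht.1 with rfl | hpos
  · exact hω0 hσ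
  · obtain ⟨n, hn⟩ := exists_nat_gt (s / t)
    refine (hω n).mono_set (Icc_subset_Icc_left ?_)
    rw [div_lt_iff₀ hpos] at hn
    rw [div_le_iff₀ (by positivity)]
    nlinarith

/-- When λ_t = λ_s the λ-integral runs over a single point, so the path enters only through `x s`
and all remaining coefficients are continuous. -/
theorem continuousOn_closedForm_zero (hS : S.IsStart s) (x : ℝ → EuclideanSpace ℝ (Fin d)) :
    ContinuousOn (fun t => closedForm S xθ xhat s x t 0)
      {t | t ∈ Icc 0 s ∧ 0 < S.σ t ∧ S.lam t = S.lam s} := by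
  have hls := hS.lam_pos hS.s_mem (hS.σ_pos s ⟨hS.pos, le_rfl⟩)
  have hα := hS.α_continuousOn
  have hη : ContinuousOn (fun t => 1 - S.η t) (Icc 0 s) :=
    continuousOn_const.sub hS.η_continuousOn
  have h1 : ContinuousOn (fun t => ((S.α t * (1 - S.η t)) / (S.α s * (1 - S.η s))) • x s
      + (S.α t * (1 - S.η t) * (S.η t / (1 - S.η t) - S.η s / (1 - S.η s))) • xhat) (Icc 0 s) :=
    (((hα.mul hη).div_const _).smul continuousOn_const).add
      (((hα.mul hη).mul ((hS.η_continuousOn.div hη fun r hr =>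
        (sub_pos.2 (hS.η_lt_one_of_mem hr)).ne').sub continuousOn_const)).smul continuousOn_const)
  refine (h1.mono fun t ht => ht.1).congr fun t ht => ?_
  simp [closedForm, ht.2.2, hls.ne']

theorem ae_eq_closedForm_zero [IsProbabilityMeasure P]
    (hS : S.IsStart s) (hw : IsBackwardWiener P 𝓕 w s)
    (hX : IsReverseSolution S xθ xhat P 𝓕 w s X) :
    ∀ᵐ ω ∂P, ∀ t ∈ Icc 0 s, 0 < S.σ t → S.lam t = S.lam s →
      X t ω = closedForm S xθ xhat s (fun r => X r ω) t 0 := by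
  set Z : Set ℝ := {t | t ∈ Icc 0 s ∧ 0 < S.σ t ∧ S.lam t = S.lam s} with hZ
  obtain ⟨D, hDc, hD⟩ := TopologicalSpace.exists_countable_dense Z
  have hpt : ∀ t ∈ D, ∀ᵐ ω ∂P,
      X (t : ℝ) ω = closedForm S xθ xhat s (fun r => X r ω) t 0 := by
    intro t _
    obtain ⟨h1, h2, h3⟩ := t.2
    obtain ⟨hm, hG⟩ := isIndepGaussian_sub_closedForm hS hw hX h1 h2
    rw [hS.noiseCoeff_eq_zero h1 h2 h3, zero_pow two_ne_zero] at hG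
    filter_upwards [hG.ae_eq_zero hm] with ω hω
    exact sub_eq_zero.1 hω
  filter_upwards [hX.cont, (ae_ball_iff hDc).2 hpt] with ω hc hω t ht hσ hl
  have hc1 : Continuous (Z.domRestrict fun t => X t ω) :=
    (hc.mono fun t (ht : t ∈ Z) => ht.1).domRestrict
  have hc2 : Continuous (Z.domRestrict fun t => closedForm S xθ xhat s (fun r => X r ω) t 0) :=
    (continuousOn_closedForm_zero hS _).domRestrict
  have heq := Continuous.ext_on hD hc1 hc2 hω
  have htZ : t ∈ Z := ⟨ht, hσ, hl⟩
  exact congrFun heq ⟨t, htZ⟩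

end Noise

end DoS

end

/-! ### The exact solution formula. -/

theorem proposition1 {d : ℕ} {Ω : Type*} {mΩ : MeasurableSpace Ω}
    (P : Measure Ω) [IsProbabilityMeasure P]
    {T : ℝ} (S : DoS.Schedule T)
    (xθ : EuclideanSpace ℝ (Fin d) → EuclideanSpace ℝ (Fin d) → ℝ → EuclideanSpace ℝ (Fin d))
    (xhat : EuclideanSpace ℝ (Fin d))
    (s : ℝ) (hs : 0 < s) (hsT : s ≤ T)
    (hα : 0 < S.α s) (hη : S.η s < 1) (hσ : ∀ t ∈ Ioc 0 s, 0 < S.σ t)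
    (𝓕 : Filtration ℝᵒᵈ mΩ) (w X : ℝ → Ω → EuclideanSpace ℝ (Fin d))
    (hw : DoS.IsBackwardWiener P 𝓕 w s)
    (hX : DoS.IsReverseSolution S xθ xhat P 𝓕 w s X) :
    ∃ z : ℝ → Ω → EuclideanSpace ℝ (Fin d),
      (∀ t ∈ Icc 0 s, HasLaw (z t) (stdGaussian (EuclideanSpace ℝ (Fin d))) P ∧
        Indep (MeasurableSpace.comap (z t) inferInstance) (𝓕 (toDual s)) P) ∧
      ∀ᵐ ω ∂P,
        (∀ t ∈ Icc 0 s, 0 < S.σ t →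
          IntervalIntegrable (DoS.integrand S xθ xhat s (fun r => X r ω) t) volume
            (S.lam s) (S.lam t) ∧
          X t ω = DoS.closedForm S xθ xhat s (fun r => X r ω) t (z t ω)) ∧
        (S.σ 0 = 0 →
          Tendsto (fun t => DoS.closedForm S xθ xhat s (fun r => X r ω) t (z t ω))
            (𝓝[>] 0) (𝓝 (X 0 ω))) := by
  have hS : S.IsStart s := ⟨hs, hsT, hα, hη, hσ⟩
  refine ⟨DoS.noise S xθ xhat s w X, fun t ht => ?_, ?_⟩
  · obtain ⟨hm, hG⟩ := DoS.isIndepGaussian_noise hS hw hX ht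
    exact ⟨hG.hasLaw (𝓕.le _) hm, hG.indep (𝓕.le _) hm⟩
  filter_upwards [hX.cont, DoS.ae_integrableOn_drift hS hX, DoS.ae_eq_closedForm_zero hS hw hX]
    with ω hc hd h0
  -- Where the noise coefficient is nonzero the identity is the definition of `noise`; only the
  -- times with λ_t = λ_s rely on the exceptional null set.
  have hform : ∀ t ∈ Icc 0 s, 0 < S.σ t → X t ω
      = DoS.closedForm S xθ xhat s (fun r => X r ω) t (DoS.noise S xθ xhat s w X t ω) := by
    intro t ht hσt
    rw [DoS.closedForm_eq_add]
    by_cases hl : S.lam t = S.lam s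
    · rw [hS.noiseCoeff_eq_zero ht hσt hl, zero_smul, add_zero]
      exact h0 t ht hσt hl
    · rw [DoS.noise, if_pos ⟨hσt, hl⟩, smul_smul, mul_inv_cancel₀ (hS.noiseCoeff_ne_zero ht hσt hl),
        one_smul, add_sub_cancel]
  refine ⟨fun t ht hσt => ⟨hS.intervalIntegrable_integrand ht hσt hc (hd t ht hσt),
    hform t ht hσt⟩, fun _ => ?_⟩
  -- The closed form agrees with the path on `(0, s]`, so its limit at 0 is path continuity.
  have h1 : Tendsto (fun t => X t ω) (𝓝[>] 0) (𝓝 (X 0 ω)) := by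
    have h2 := (hc 0 ⟨le_rfl, hs.le⟩).mono (Ioc_subset_Icc_self (a := (0 : ℝ)) (b := s))
    rwa [ContinuousWithinAt, nhdsWithin_Ioc_eq_nhdsGT hs] at h2
  refine h1.congr' ?_
  filter_upwards [Ioc_mem_nhdsGT hs] with t ht
  exact hform t (Ioc_subset_Icc_self ht) (hσ t ht)
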